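/- **Setting.** Let $\mathcal V$ be a commutative unital quantale with multiplication $\otimes$ and unit $k$, which is integral ($k=\top$). For $x,y\in\mathcal V$ write $y\ll x$ if every $X\subseteq\mathcal V$ with $x\le\bigvee X$ has a finite subset $F$ with $y\le\bigvee F$. Assume that the lattice $\mathcal V$ is continuous ($x=\bigvee\{y\mid y\ll x\}$ for all $x$), and fix a basis $B\subseteq\mathcal V$ (for every $x$ the set $\{y\in B\mid y\ll x\}$ is directed with least upper bound $x$) that is closed under finite joins (including the empty one) and under $\otimes$, and contains $k$. **Affine $\lambda$-calculus.** Let $G$ be a class of ground types; types are $A::=X\in G\mid I\mid A\otimes A\mid A\multimap A$. Let $\Sigma$ be a class of operation symbols $f:A_1,\dots,A_n\to A$ with $n\ge1$. Contexts are lists of distinct typed variables; $\mathrm{Sf}(\Gamma_1;\dots;\Gamma_n)$ is the set of shuffles, i.e. permutations of $\Gamma_1,\dots,\Gamma_n$ that preserve the order inside each $\Gamma_i$. Judgements (up to renaming of variables) are derived by: - $x:A\rhd x:A$, and $-\rhd *:I$; - if $\Gamma_i\rhd v_i:A_i$ for $i\le n$, $f:A_1,\dots,A_n\to A$ and $E\in\mathrm{Sf}(\Gamma_1;\dots;\Gamma_n)$,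 then $E\rhd f(v_1,\dots,v_n):A$; - for $E\in\mathrm{Sf}(\Gamma;\Delta)$: from $\Gamma\rhd v:A$ and $\Delta\rhd w:B$ infer $E\rhd v\otimes w:A\otimes B$; from $\Gamma\rhd v:A\otimes B$ and $\Delta,x:A,y:B\rhd w:C$ infer $E\rhd \mathtt{pm}\ v\ \mathtt{to}\ x\otimes y.\,w:C$; from $\Gamma\rhd v:I$ and $\Delta\rhd w:A$ infer $E\rhd v\ \mathtt{to}\ *.\,w:A$; from $\Gamma\rhd v:A\multimap B$ and $\Delta\rhd w:A$ infer $E\rhd v\,w:B$; - from $\Gamma,x:A\rhd v:B$ infer $\Gamma\rhd\lambda x:A.\,v:A\multimap B$; from $\Gamma\rhd v:A$ infer $\Gamma\rhd\mathtt{dis}(v):I$. **Theories and theorems.** A $\mathcal V$-equation-in-context is an expression $\Gamma\rhd v=_q w:A$ with $q\in B$, $\Gamma\rhd v:A$ and $\Gamma\rhd w:A$; an equation $v=w$ stands for the two $\mathcal V$-equations $v=_\top w$ and $w=_\top v$. An affine $\mathcal V\lambda$-theory $\mathscr T=((G,\Sigma),Ax)$ is given by a class $Ax$ of $\mathcal V$-equations-in-context.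 Its theorems form the smallest class that contains $Ax$ and all well-typed instances of the equations $$\mathtt{pm}\ v\otimes w\ \mathtt{to}\ x\otimes y.\,u=u[v/x,w/y],\qquad \mathtt{pm}\ v\ \mathtt{to}\ x\otimes y.\,u[x\otimes y/z]=u[v/z],$$ $$*\ \mathtt{to}\ *.\,v=v,\qquad v\ \mathtt{to}\ *.\,w[*/z]=w[v/z],\qquad(\lambda x:A.\,v)\,w=v[w/x],\qquad\lambda x:A.\,(v\,x)=v,$$ $$u[v\ \mathtt{to}\ *.\,w/z]=v\ \mathtt{to}\ *.\,u[w/z],\qquad u[\mathtt{pm}\ v\ \mathtt{to}\ x\otimes y.\,w/z]=\mathtt{pm}\ v\ \mathtt{to}\ x\otimes y.\,u[w/z],$$ $$\mathtt{dis}(v)=\mathtt{dis}(x_1)\ \mathtt{to}\ *.\,\dots\ \mathtt{dis}(x_n)\ \mathtt{to}\ *.\,*\quad(x_1,\dots,x_n\text{ the context of }v),\qquad v\ \mathtt{to}\ *.\,*=\mathtt{dis}(v)\ \mathtt{to}\ *.\,*$$ and is closed under the following rules (all labels in $B$): $v=_\top v$; from $v=_qw$ and $w=_ru$ infer $v=_{q\otimes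 r}u$; from $v=_qw$ and $r\le q$ infer $v=_rw$; from $v=_rw$ for all $r\ll q$ with $r\in B$ infer $v=_qw$; from $v=_{q_i}w$ for $i\le n$ ($n\ge0$) infer $v=_{\bigvee q_i}w$; compatibility with every term former, the labels of the premises being multiplied (so $\lambda x:A.\,v=_q\lambda x:A.\,w$ and $\mathtt{dis}(v)=_q\mathtt{dis}(w)$ from $v=_qw$); permutation of the context; and from $v=_qw$ and $v'=_rw'$ infer $v[v'/x]=_{q\otimes r}w[w'/x]$. For types $A,A'$ let $a(v,w)=\bigvee\{q\mid v=_qw\text{ is a theorem}\}$ for terms $x:A\rhd v,w:A'$, and let $\mathrm{Syn}(\mathscr T)(A,A')$ be the class of these terms modulo the relation "$k\le a(v,w)$ and $k\le a(w,v)$"; these are the hom-classes of the syntactic category $\mathrm{Syn}(\mathscr T)$, whose objects are the types. $\mathscr T$ is *varietal* if all of them are small (sets). **Models.** A $\mathcal V\text{-}\mathsf{Cat}_{\mathsf{sep}}$-enriched affine category is a locally small symmetric monoidal closed category $\mathsf C$ whose unit $I$ is terminal, with functions $a:\mathsf C(X,Y)\times\mathsf C(X,Y)\to\mathcal V$ such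 that $k\le a(f,f)$, $a(f,g)\otimes a(g,h)\le a(f,h)$, and $f=g$ whenever $k\le a(f,g)$ and $k\le a(g,f)$; moreover $a(f,f')\otimes a(g,g')\le a(g\cdot f,g'\cdot f')$ and $a(f,f')\otimes a(g,g')\le a(f\otimes g,f'\otimes g')$, and the currying bijection between $\mathsf C(X\otimes Y,Z)$ and $\mathsf C(X,Y\multimap Z)$ preserves $a$. An interpretation in $\mathsf C$ assigns an object to each ground type and a morphism $[\![f]\!]:[\![A_1]\!]\otimes\dots\otimes[\![A_n]\!]\to[\![A]\!]$ to each $f:A_1,\dots,A_n\to A$ in $\Sigma$; it extends in the usual way to types, contexts (left-bracketed tensors) and judgements, $\mathtt{dis}(v)$ being interpreted as $[\![v]\!]$ followed by the unique morphism to $I$. It satisfies $\Gamma\rhd v=_qw:A$ if $q\le a([\![v]\!],[\![w]\!])$, and it is a model of $\mathscr T$ if it satisfies all axioms in $Ax$. **Theorem (soundness and completeness).** Let $\mathscr T$ be a varietal affine $\mathcal V\lambda$-theory. A $\mathcal V$-equation-in-context $\Gamma\rhd v=_qw:A$ is a theorem of $\mathscr T$ if and only if it is satisfied by all models of $\mathscr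 T$ in $\mathcal V\text{-}\mathsf{Cat}_{\mathsf{sep}}$-enriched affine categories. Moreover the unit $I$ is terminal in the syntactic category: for every type $A$, $\mathrm{Syn}(\mathscr T)(A,I)$ has exactly one element. -/

import Mathlib

open CategoryTheory MonoidalCategory

universe x u u' v w

namespace AffineLambda

/-! ### Order-theoretic preliminaries -/

/-- `y ≪ x` in a complete lattice: whenever `x ≤ ⋁ X` there is a finite `F ⊆ X` with
`y ≤ ⋁ F`. -/
def WayBelow {L : Type x} [CompleteLattice L] (y x : L) : Prop :=
  ∀ X : Set L, x ≤ sSup X → ∃ F : Set L, F ⊆ X ∧ F.Finite ∧ y ≤ sSup F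

/-- A continuous lattice: every element is the join of the elements way-below it. -/
def IsContinuousLattice (L : Type x) [CompleteLattice L] : Prop :=
  ∀ x : L, x = sSup {y : L | WayBelow y x}

/-- A basis of a complete lattice: for every `x`, the elements of `B` that are way-below `x` form
a directed set with least upper bound `x`. -/
def IsLatticeBasis {L : Type x} [CompleteLattice L] (B : Set L) : Prop :=
  ∀ x : L, (B ∩ {y : L | WayBelow y x}).Nonempty ∧
    DirectedOn (· ≤ ·) (B ∩ {y : L | WayBelow y x}) ∧ IsLUB (B ∩ {y : L | WayBelow y x}) x

/-! ### Types, contexts, shuffles -/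

/-- Types over a class `G` of ground types: ground types, the unit `I`, `A ⊗ B` and `A ⊸ B`. -/
inductive Ty (G : Type u) : Type u
  | ground : G → Ty G
  | unit : Ty G
  | tensor : Ty G → Ty G → Ty G
  | hom : Ty G → Ty G → Ty G

/-- Typing contexts `x₁ : A₁, …, xₙ : Aₙ`, up to the choice of the names of the variables. The most
recent variable comes first: the context `Γ, x : A` is the list `A :: Γ`. -/
abbrev Ctx (G : Type u) : Type u := List (Ty G)

/-- `Shuffle Γ Δ E` is the type of ways in which `E` is a shuffle of `Γ` and `Δ`, i.e. a permutation
of the variables of `Γ, Δ` that preserves the relative order of the variables of `Γ` and of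
those of `Δ`. -/
inductive Shuffle {α : Type u} : List α → List α → List α → Type u
  | nil : Shuffle [] [] []
  | left {A : α} {Γ Δ E : List α} : Shuffle Γ Δ E → Shuffle (A :: Γ) Δ (A :: E)
  | right {A : α} {Γ Δ E : List α} : Shuffle Γ Δ E → Shuffle Γ (A :: Δ) (A :: E)

/-- `Pick A Γ E` is the type of variables of type `A` in `E` whose removal from `E` leaves `Γ`. -/
inductive Pick {α : Type u} (A : α) : List α → List α → Type u
  | here {Γ : List α} : Pick A Γ (A :: Γ)
  | there {B : α} {Γ E : List α} : Pick A Γ E → Pick A (B :: Γ) (B :: E)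

namespace Shuffle

variable {α : Type u}

/-- The only shuffle of `Γ` and the empty context. -/
def allLeft : (Γ : List α) → Shuffle Γ [] Γ
  | [] => nil
  | _ :: Γ => left (allLeft Γ)

/-- The only shuffle of the empty context and `Γ`. -/
def allRight : (Γ : List α) → Shuffle [] Γ Γ
  | [] => nil
  | _ :: Γ => right (allRight Γ)

/-- A shuffle of `Γ` and `Δ` is a shuffle of `Δ` and `Γ`. -/
def swap : {Γ Δ E : List α} → Shuffle Γ Δ E → Shuffle Δ Γ E
  | _, _, _, nil => nil
  | _, _, _, left s => right s.swap
  | _, _, _, right s => left s.swap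

theorem eq_of_nil_left {Δ E : List α} (s : Shuffle [] Δ E) : Δ = E := by
  induction Δ generalizing E with
  | nil => cases s; rfl
  | cons A Δ ih => cases s with | right s => rw [ih s]

/-- Rebracketing: a shuffle of (a shuffle `X` of `Γ` and `Δ`) and `Θ` is a shuffle of `Γ` and (a
shuffle `Y` of `Δ` and `Θ`). -/
def assoc : {Γ Δ X Θ E : List α} → Shuffle Γ Δ X → Shuffle X Θ E →
    (Y : List α) × Shuffle Δ Θ Y × Shuffle Γ Y E
  | _, _, _, _, _, nil, nil => ⟨[], nil, nil⟩
  | _, _, _, _, _, s, right (A := A) t =>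
    let r := assoc s t
    ⟨A :: r.1, right r.2.1, right r.2.2⟩
  | _, _, _, _, _, left s, left t =>
    let r := assoc s t
    ⟨r.1, r.2.1, left r.2.2⟩
  | _, _, _, _, _, right (A := A) s, left t =>
    let r := assoc s t
    ⟨A :: r.1, left r.2.1, right r.2.2⟩

/-- A variable of a shuffle of `Γ₁` and `Γ₂` is a variable of `Γ₁` or a variable of `Γ₂`. -/
def locate {A : α} : {Γ₁ Γ₂ E Γ : List α} → Shuffle Γ₁ Γ₂ E → Pick A Γ E →
    ((Γ₁' : List α) × Pick A Γ₁' Γ₁ × Shuffle Γ₁' Γ₂ Γ) ⊕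
      ((Γ₂' : List α) × Pick A Γ₂' Γ₂ × Shuffle Γ₁ Γ₂' Γ)
  | _, _, _, _, left s, .here => .inl ⟨_, .here, s⟩
  | _, _, _, _, right s, .here => .inr ⟨_, .here, s⟩
  | _, _, _, _, left s, .there p =>
    match locate s p with
    | .inl ⟨_, p', s'⟩ => .inl ⟨_, .there p', left s'⟩
    | .inr ⟨_, p', s'⟩ => .inr ⟨_, p', left s'⟩
  | _, _, _, _, right s, .there p =>
    match locate s p with
    | .inl ⟨_, p', s'⟩ => .inl ⟨_, p', right s'⟩
    | .inr ⟨_, p', s'⟩ => .inr ⟨_, .there p', right s'⟩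

end Shuffle

/-! ### Affine lambda-terms -/

/-- Sorted operation symbols `f : A₁, …, Aₙ → A` with `n ≥ 1`. As for contexts, the list `dom f`
of the argument types has `Aₙ` first and `A₁` last. -/
structure Signature (G : Type u) : Type (max u (u' + 1)) where
  Op : Type u'
  dom : Op → List (Ty G)
  cod : Op → Ty G
  dom_ne_nil : ∀ f, dom f ≠ []

mutual

/-- `Tm S Γ A` is the type of affine lambda-terms `v` with `Γ ▷ v : A`, up to renaming of
variables. As every such judgement has exactly one derivation, they are given as
derivations: one constructor for each term formation rule. -/
inductive Tm {G : Type u} (S : Signature.{u, u'} G) : Ctx G → Ty G → Type (max u u')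
  /-- `x : A ▷ x : A` -/
  | var {A : Ty G} : Tm S [A] A
  /-- `E ▷ f(v₁, …, vₙ) : A` -/
  | op {E : Ctx G} (f : S.Op) (as : Args S E (S.dom f)) : Tm S E (S.cod f)
  /-- `- ▷ * : I` -/
  | star : Tm S [] Ty.unit
  /-- `E ▷ v to *. w : A` -/
  | unitE {Γ Δ E : Ctx G} {A : Ty G} (v : Tm S Γ Ty.unit) (w : Tm S Δ A) (s : Shuffle Γ Δ E) :
      Tm S E A
  /-- `E ▷ v ⊗ w : A ⊗ B` -/
  | tensor {Γ Δ E : Ctx G} {A B : Ty G} (v : Tm S Γ A) (w : Tm S Δ B) (s : Shuffle Γ Δ E) :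
      Tm S E (Ty.tensor A B)
  /-- `E ▷ pm v to x ⊗ y. w : C` -/
  | pm {Γ Δ E : Ctx G} {A B C : Ty G} (v : Tm S Γ (Ty.tensor A B)) (w : Tm S (B :: A :: Δ) C)
      (s : Shuffle Γ Δ E) : Tm S E C
  /-- `Γ ▷ λ x : A. v : A ⊸ B` -/
  | lam {Γ : Ctx G} {A B : Ty G} (v : Tm S (A :: Γ) B) : Tm S Γ (Ty.hom A B)
  /-- `E ▷ v w : B` -/
  | app {Γ Δ E : Ctx G} {A B : Ty G} (v : Tm S Γ (Ty.hom A B)) (w : Tm S Δ A)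
      (s : Shuffle Γ Δ E) : Tm S E B
  /-- `Γ ▷ dis(v) : I` -/
  | dis {Γ : Ctx G} {A : Ty G} (v : Tm S Γ A) : Tm S Γ Ty.unit

/-- `Args S E [Aₙ, …, A₁]` is the type of families of terms `Γᵢ ▷ vᵢ : Aᵢ`, `1 ≤ i ≤ n`, together
with a presentation of `E` as a shuffle of `Γ₁; …; Γₙ`. -/
inductive Args {G : Type u} (S : Signature.{u, u'} G) : Ctx G → List (Ty G) → Type (max u u')
  | nil : Args S [] []
  | snoc {Γ Δ E : Ctx G} {As : List (Ty G)} {A : Ty G} (as : Args S Γ As) (v : Tm S Δ A)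
      (s : Shuffle Γ Δ E) : Args S E (A :: As)

end

section Substitution

variable {G : Type u} {S : Signature.{u, u'} G}

mutual

/-- Substitution `v[w/z]`, where `z : A` is a variable of the context of `v` (its other variables
being `Γ`), `Δ ▷ w : A`, and the context `F` of the result is any shuffle of `Γ` and `Δ`. -/
def Tm.subst {A : Ty G} {Δ : Ctx G} : {E Γ F : Ctx G} → {B : Ty G} → Tm S E B → Pick A Γ E →
    Tm S Δ A → Shuffle Γ Δ F → Tm S F B
  | _, _, _, _, .var, .here, w, t => t.eq_of_nil_left ▸ w
  | _, _, _, _, .op f as, p, w, t => .op f (as.subst p w t)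
  | _, _, _, _, .unitE v₁ v₂ s, p, w, t =>
    match s.locate p with
    | .inl ⟨_, p', s'⟩ =>
      let r := s'.swap.assoc t
      .unitE (v₁.subst p' w r.2.1) v₂ r.2.2.swap
    | .inr ⟨_, p', s'⟩ =>
      let r := s'.assoc t
      .unitE v₁ (v₂.subst p' w r.2.1) r.2.2
  | _, _, _, _, .tensor v₁ v₂ s, p, w, t =>
    match s.locate p with
    | .inl ⟨_, p', s'⟩ =>
      let r := s'.swap.assoc t
      .tensor (v₁.subst p' w r.2.1) v₂ r.2.2.swap
    | .inr ⟨_, p', s'⟩ =>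
      let r := s'.assoc t
      .tensor v₁ (v₂.subst p' w r.2.1) r.2.2
  | _, _, _, _, .pm v₁ v₂ s, p, w, t =>
    match s.locate p with
    | .inl ⟨_, p', s'⟩ =>
      let r := s'.swap.assoc t
      .pm (v₁.subst p' w r.2.1) v₂ r.2.2.swap
    | .inr ⟨_, p', s'⟩ =>
      let r := s'.assoc t
      .pm v₁ (v₂.subst (.there (.there p')) w (.left (.left r.2.1))) r.2.2
  | _, _, _, _, .lam v, p, w, t => .lam (v.subst (.there p) w (.left t))
  | _, _, _, _, .app v₁ v₂ s, p, w, t =>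
    match s.locate p with
    | .inl ⟨_, p', s'⟩ =>
      let r := s'.swap.assoc t
      .app (v₁.subst p' w r.2.1) v₂ r.2.2.swap
    | .inr ⟨_, p', s'⟩ =>
      let r := s'.assoc t
      .app v₁ (v₂.subst p' w r.2.1) r.2.2
  | _, _, _, _, .dis v, p, w, t => .dis (v.subst p w t)

/-- Substitution in a family of arguments. -/
def Args.subst {A : Ty G} {Δ : Ctx G} : {E Γ F : Ctx G} → {As : List (Ty G)} → Args S E As →
    Pick A Γ E → Tm S Δ A → Shuffle Γ Δ F → Args S F As
  | _, _, _, _, .snoc as v s, p, w, t =>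
    match s.locate p with
    | .inl ⟨_, p', s'⟩ =>
      let r := s'.swap.assoc t
      .snoc (as.subst p' w r.2.1) v r.2.2.swap
    | .inr ⟨_, p', s'⟩ =>
      let r := s'.assoc t
      .snoc as (v.subst p' w r.2.1) r.2.2

end

/-- The judgement obtained from `E ▷ v : B` by moving one variable of `E` to another position of
the context. (The named term stays the same. Such moves generate all permutations.) -/
def Tm.move {A B : Ty G} {E Γ F : Ctx G} (v : Tm S E B) (p : Pick A Γ E) (t : Shuffle Γ [A] F) :
    Tm S F B :=
  v.subst p .var t

/-- The term `dis(xₙ) to *. … dis(x₁) to *. *` in the context `x₁ : A₁, …, xₙ : Aₙ`. -/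
def discardAll : (Γ : Ctx G) → Tm S Γ Ty.unit
  | [] => .star
  | _ :: Γ => .unitE (.dis .var) (discardAll Γ) (.left (.allRight Γ))

end Substitution

/-! ### The deductive system -/

/-- The classical equations `v = w` of the affine calculus: the equations of autonomous categories
and the two equations for `dis`. -/
inductive Eqn {G : Type u} {S : Signature.{u, u'} G} :
    {Γ : Ctx G} → {A : Ty G} → Tm S Γ A → Tm S Γ A → Prop
  /-- `pm v ⊗ w to x ⊗ y. u = u[v/x, w/y]` -/
  | tensor_beta {Γ Δ Θ F E : Ctx G} {A B C : Ty G} (v : Tm S Γ A) (w : Tm S Δ B)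
      (u : Tm S (B :: A :: Θ) C) (s : Shuffle Γ Δ F) (t : Shuffle F Θ E) :
      Eqn (.pm (.tensor v w s) u t)
        ((u.subst .here w (.left (s.assoc t).2.1.swap)).subst .here v (s.assoc t).2.2.swap)
  /-- `pm v to x ⊗ y. u[x ⊗ y/z] = u[v/z]` -/
  | tensor_eta {Γ Δ X E : Ctx G} {A B C : Ty G} (v : Tm S Γ (Ty.tensor A B)) (u : Tm S X C)
      (p : Pick (Ty.tensor A B) Δ X) (s : Shuffle Γ Δ E) :
      Eqn (.pm v (u.subst p (.tensor .var .var (.right (.left .nil)))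
          (.right (.right (.allLeft Δ)))) s)
        (u.subst p v s.swap)
  /-- `* to *. v = v` -/
  | unit_beta {Γ : Ctx G} {A : Ty G} (v : Tm S Γ A) : Eqn (.unitE .star v (.allRight Γ)) v
  /-- `v to *. w[*/z] = w[v/z]` -/
  | unit_eta {Γ Δ X E : Ctx G} {A : Ty G} (v : Tm S Γ Ty.unit) (w : Tm S X A)
      (p : Pick Ty.unit Δ X) (s : Shuffle Γ Δ E) :
      Eqn (.unitE v (w.subst p .star (.allLeft Δ)) s) (w.subst p v s.swap)
  /-- `(λ x : A. v) w = v[w/x]` -/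
  | hom_beta {Γ Δ E : Ctx G} {A B : Ty G} (v : Tm S (A :: Γ) B) (w : Tm S Δ A)
      (s : Shuffle Γ Δ E) : Eqn (.app (.lam v) w s) (v.subst .here w s)
  /-- `λ x : A. (v x) = v` -/
  | hom_eta {Γ : Ctx G} {A B : Ty G} (v : Tm S Γ (Ty.hom A B)) :
      Eqn (.lam (.app v .var (.right (.allLeft Γ)))) v
  /-- `u[v to *. w/z] = v to *. u[w/z]` -/
  | unit_comm {Γ Δ Θ X F E : Ctx G} {A B : Ty G} (v : Tm S Γ Ty.unit) (w : Tm S Δ A)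
      (s : Shuffle Γ Δ F) (u : Tm S X B) (p : Pick A Θ X) (t : Shuffle Θ F E) :
      Eqn (u.subst p (.unitE v w s) t)
        (.unitE v (u.subst p w (s.assoc t.swap).2.1.swap) (s.assoc t.swap).2.2)
  /-- `u[pm v to x ⊗ y. w/z] = pm v to x ⊗ y. u[w/z]` -/
  | tensor_comm {Γ Δ Θ X F E : Ctx G} {A B C D : Ty G} (v : Tm S Γ (Ty.tensor A B))
      (w : Tm S (B :: A :: Δ) C) (s : Shuffle Γ Δ F) (u : Tm S X D) (p : Pick C Θ X)
      (t : Shuffle Θ F E) :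
      Eqn (u.subst p (.pm v w s) t)
        (.pm v (u.subst p w (.right (.right (s.assoc t.swap).2.1.swap))) (s.assoc t.swap).2.2)
  /-- `dis(v) = dis(xₙ) to *. … dis(x₁) to *. *`; the discarded variables come in any other order
  by exchange. -/
  | dis_all {Γ : Ctx G} {A : Ty G} (v : Tm S Γ A) : Eqn (.dis v) (discardAll Γ)
  /-- `v to *. * = dis(v) to *. *` -/
  | dis_unit {Γ : Ctx G} (v : Tm S Γ Ty.unit) :
      Eqn (.unitE v .star (.allLeft Γ)) (.unitE (.dis v) .star (.allLeft Γ))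

/-- An affine `V`-lambda-theory over the signature `S`: a class `Ax` of `V`-equations in context
`Γ ▷ v =_q w : A`, the labels `q` being taken from the basis `B` of `V`. -/
structure AffineTheory (V : Type x) (B : Set V) {G : Type u} (S : Signature.{u, u'} G) where
  Ax : {Γ : Ctx G} → {A : Ty G} → Tm S Γ A → V → Tm S Γ A → Prop
  label_mem : ∀ {Γ : Ctx G} {A : Ty G} (v w : Tm S Γ A) (q : V), Ax v q w → q ∈ B

section Theorems

variable {V : Type x} [CommMonoid V] [CompleteLattice V] {B : Set V} {G : Type u}
  {S : Signature.{u, u'} G}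

mutual

/-- `Thm T v q w`: the `V`-equation `v =_q w` is a theorem of `T`. -/
inductive Thm (T : AffineTheory V B S) : {Γ : Ctx G} → {A : Ty G} → Tm S Γ A → V → Tm S Γ A → Prop
  | ax {Γ : Ctx G} {A : Ty G} {v w : Tm S Γ A} {q : V} : T.Ax v q w → Thm T v q w
  | eqn {Γ : Ctx G} {A : Ty G} {v w : Tm S Γ A} : Eqn v w → Thm T v ⊤ w
  | eqn_symm {Γ : Ctx G} {A : Ty G} {v w : Tm S Γ A} : Eqn v w → Thm T w ⊤ v
  | refl {Γ : Ctx G} {A : Ty G} (v : Tm S Γ A) : Thm T v ⊤ v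
  | trans {Γ : Ctx G} {A : Ty G} {v w u : Tm S Γ A} {q r : V} :
      Thm T v q w → Thm T w r u → Thm T v (q * r) u
  | weak {Γ : Ctx G} {A : Ty G} {v w : Tm S Γ A} {q r : V} :
      Thm T v q w → r ∈ B → r ≤ q → Thm T v r w
  | arch {Γ : Ctx G} {A : Ty G} {v w : Tm S Γ A} {q : V} :
      q ∈ B → (∀ r ∈ B, WayBelow r q → Thm T v r w) → Thm T v q w
  | join {Γ : Ctx G} {A : Ty G} {v w : Tm S Γ A} {n : ℕ} (q : Fin n → V) :
      (∀ i, Thm T v (q i) w) → Thm T v (⨆ i, q i) w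
  | op {E : Ctx G} (f : S.Op) {as bs : Args S E (S.dom f)} {q : V} :
      ThmArgs T as q bs → Thm T (.op f as) q (.op f bs)
  | unitE {Γ Δ E : Ctx G} {A : Ty G} {v w : Tm S Γ Ty.unit} {v' w' : Tm S Δ A} {q r : V}
      (s : Shuffle Γ Δ E) :
      Thm T v q w → Thm T v' r w' → Thm T (.unitE v v' s) (q * r) (.unitE w w' s)
  | tensor {Γ Δ E : Ctx G} {A A' : Ty G} {v w : Tm S Γ A} {v' w' : Tm S Δ A'} {q r : V}
      (s : Shuffle Γ Δ E) :
      Thm T v q w → Thm T v' r w' → Thm T (.tensor v v' s) (q * r) (.tensor w w' s)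
  | pm {Γ Δ E : Ctx G} {A A' C : Ty G} {v w : Tm S Γ (Ty.tensor A A')}
      {v' w' : Tm S (A' :: A :: Δ) C} {q r : V} (s : Shuffle Γ Δ E) :
      Thm T v q w → Thm T v' r w' → Thm T (.pm v v' s) (q * r) (.pm w w' s)
  | lam {Γ : Ctx G} {A A' : Ty G} {v w : Tm S (A :: Γ) A'} {q : V} :
      Thm T v q w → Thm T (.lam v) q (.lam w)
  | app {Γ Δ E : Ctx G} {A A' : Ty G} {v w : Tm S Γ (Ty.hom A A')} {v' w' : Tm S Δ A} {q r : V}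
      (s : Shuffle Γ Δ E) :
      Thm T v q w → Thm T v' r w' → Thm T (.app v v' s) (q * r) (.app w w' s)
  | dis {Γ : Ctx G} {A : Ty G} {v w : Tm S Γ A} {q : V} :
      Thm T v q w → Thm T (.dis v) q (.dis w)
  | exch {A A' : Ty G} {E Γ F : Ctx G} {v w : Tm S E A'} {q : V} (p : Pick A Γ E)
      (t : Shuffle Γ [A] F) : Thm T v q w → Thm T (v.move p t) q (w.move p t)
  | subst {A A' : Ty G} {E Γ Δ F : Ctx G} {v w : Tm S E A'} {v' w' : Tm S Δ A} {q r : V}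
      (p : Pick A Γ E) (t : Shuffle Γ Δ F) :
      Thm T v q w → Thm T v' r w' → Thm T (v.subst p v' t) (q * r) (w.subst p w' t)

/-- Families of theorems `vᵢ =_{qᵢ} wᵢ`, labelled by the product of the `qᵢ`. -/
inductive ThmArgs (T : AffineTheory V B S) :
    {E : Ctx G} → {As : List (Ty G)} → Args S E As → V → Args S E As → Prop
  | nil : ThmArgs T .nil 1 .nil
  | snoc {Γ Δ E : Ctx G} {As : List (Ty G)} {A : Ty G} {as bs : Args S Γ As} {v w : Tm S Δ A}
      {q r : V} (s : Shuffle Γ Δ E) :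
      ThmArgs T as q bs → Thm T v r w → ThmArgs T (.snoc as v s) (q * r) (.snoc bs w s)

end

/-- The function `a(v, w) = ⋁ {q | v =_q w is a theorem}`. -/
noncomputable def AffineTheory.synDist (T : AffineTheory V B S) {Γ : Ctx G} {A : Ty G}
    (v w : Tm S Γ A) : V :=
  sSup {q : V | Thm T v q w}

/-- The morphisms `A → A'` of the syntactic category: the terms `x : A ▷ v : A'`, where `v` and `w`
are identified if `k ≤ a(v, w)` and `k ≤ a(w, v)`. -/
def AffineTheory.SynHom (T : AffineTheory V B S) (A A' : Ty G) : Type (max u u') :=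
  Quot fun v w : Tm S [A] A' => 1 ≤ T.synDist v w ∧ 1 ≤ T.synDist w v

/-- Varietal theories: the hom-classes of the syntactic category are small. -/
def AffineTheory.Varietal (T : AffineTheory V B S) : Prop :=
  ∀ A A' : Ty G, Small.{v} (T.SynHom A A')

end Theorems

/-! ### Enriched affine categories -/

/-- `(X, a)` is a `V`-category. -/
structure IsVCategory {V : Type x} [CommMonoid V] [CompleteLattice V] {X : Type v}
    (a : X → X → V) : Prop where
  refl : ∀ f, 1 ≤ a f f
  trans : ∀ f g h, a f g * a g h ≤ a f h

/-- The natural order of the `V`-category `(X, a)` is antisymmetric. -/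
def IsSeparated {V : Type x} [CommMonoid V] [CompleteLattice V] {X : Type v}
    (a : X → X → V) : Prop :=
  ∀ f g, 1 ≤ a f g → 1 ≤ a g f → f = g

/-- A `V-Cat_sep`-enriched affine category: an autonomous (symmetric monoidal closed) category whose
unit is terminal, enriched over separated `V`-categories, with an enriched tensor and enriched
adjunctions between tensor and internal hom. -/
class EnrichedAffine (V : Type x) [CommMonoid V] [CompleteLattice V] (C : Type w) [Category.{v} C]
    [SemiCartesianMonoidalCategory C] [SymmetricCategory C] [MonoidalClosed C] where
  /-- the hom-`V`-categories -/
  hdist : {X Y : C} → (X ⟶ Y) → (X ⟶ Y) → V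
  isVCategory : ∀ X Y : C, IsVCategory (hdist (X := X) (Y := Y))
  isSeparated : ∀ X Y : C, IsSeparated (hdist (X := X) (Y := Y))
  /-- composition is a `V`-functor -/
  comp_le : ∀ {X Y Z : C} (f f' : X ⟶ Y) (g g' : Y ⟶ Z),
    hdist f f' * hdist g g' ≤ hdist (f ≫ g) (f' ≫ g')
  /-- the tensor is an enriched functor -/
  tensor_le : ∀ {X Y X' Y' : C} (f f' : X ⟶ Y) (g g' : X' ⟶ Y'),
    hdist f f' * hdist g g' ≤ hdist (f ⊗ₘ g) (f' ⊗ₘ g')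
  /-- transposition is an isomorphism of `V`-categories -/
  curry_eq : ∀ {X Y Z : C} (f g : X ⊗ Y ⟶ Z),
    hdist (MonoidalClosed.curry f) (MonoidalClosed.curry g) = hdist f g

/-! ### Interpretation -/

section Semantics

variable {G : Type u} {C : Type w} [Category.{v} C] [SemiCartesianMonoidalCategory C]
  [SymmetricCategory C] [MonoidalClosed C]

/-- Interpretation of types. -/
def tyObj (ob : G → C) : Ty G → C
  | .ground X => ob X
  | .unit => 𝟙_ C
  | .tensor A B => tyObj ob A ⊗ tyObj ob B
  | .hom A B => (ihom (tyObj ob A)).obj (tyObj ob B)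

/-- Interpretation of contexts, and the tensor `A₁ ⊗ … ⊗ Aₙ`, bracketed to the left. -/
def ctxObj (ob : G → C) : Ctx G → C
  | [] => 𝟙_ C
  | [A] => tyObj ob A
  | A :: B :: Γ => ctxObj ob (B :: Γ) ⊗ tyObj ob A

/-- The morphism that splits `Γ, x : A` into `Γ` and `x : A`. -/
def snocIso (ob : G → C) : (Γ : Ctx G) → (A : Ty G) →
    (ctxObj ob (A :: Γ) ≅ ctxObj ob Γ ⊗ tyObj ob A)
  | [], A => (λ_ (tyObj ob A)).symm
  | _ :: _, _ => Iso.refl _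

/-- The morphism from `E` to `Γ ⊗ Δ` for a shuffle `E` of `Γ` and `Δ`: the composition of the
shuffling morphism from `E` to `Γ, Δ` and the morphism that splits `Γ, Δ` into `Γ` and `Δ`. -/
def splitHom (ob : G → C) : {Γ Δ E : Ctx G} → Shuffle Γ Δ E →
    (ctxObj ob E ⟶ ctxObj ob Γ ⊗ ctxObj ob Δ)
  | _, _, _, .nil => (λ_ (𝟙_ C)).inv
  | _, _, _, .left (A := A) (Γ := Γ) (Δ := Δ) (E := E) s =>
    (snocIso ob E A).hom ≫ splitHom ob s ▷ tyObj ob A ≫ (α_ _ _ _).hom ≫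
      ctxObj ob Γ ◁ (β_ (ctxObj ob Δ) (tyObj ob A)).hom ≫ (α_ _ _ _).inv ≫
        (snocIso ob Γ A).inv ▷ ctxObj ob Δ
  | _, _, _, .right (A := A) (Γ := Γ) (Δ := Δ) (E := E) s =>
    (snocIso ob E A).hom ≫ splitHom ob s ▷ tyObj ob A ≫ (α_ _ _ _).hom ≫
      ctxObj ob Γ ◁ (snocIso ob Δ A).inv

/-- An interpretation of the ground types and of the operation symbols. -/
structure Interpretation (S : Signature.{u, u'} G) (C : Type w) [Category.{v} C]
    [SemiCartesianMonoidalCategory C] [SymmetricCategory C] [MonoidalClosed C] where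
  ob : G → C
  op : ∀ f : S.Op, ctxObj ob (S.dom f) ⟶ tyObj ob (S.cod f)

variable {S : Signature.{u, u'} G}

mutual

/-- Interpretation of judgements. -/
def Interpretation.tm (M : Interpretation S C) : {Γ : Ctx G} → {A : Ty G} → Tm S Γ A →
    (ctxObj M.ob Γ ⟶ tyObj M.ob A)
  | _, _, .var (A := A) => 𝟙 (tyObj M.ob A)
  | _, _, .op f as => M.args as ≫ M.op f
  | _, _, .star => 𝟙 (𝟙_ C)
  | _, _, .unitE (Δ := Δ) v w s =>
    splitHom M.ob s ≫ M.tm v ▷ ctxObj M.ob Δ ≫ (λ_ (ctxObj M.ob Δ)).hom ≫ M.tm w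
  | _, _, .tensor v w s => splitHom M.ob s ≫ (M.tm v ⊗ₘ M.tm w)
  | _, _, .pm (Δ := Δ) (A := A) (B := B) v w s =>
    splitHom M.ob s ≫ M.tm v ▷ ctxObj M.ob Δ ≫
      (β_ (tyObj M.ob A ⊗ tyObj M.ob B) (ctxObj M.ob Δ)).hom ≫ (α_ _ _ _).inv ≫
        (snocIso M.ob Δ A).inv ▷ tyObj M.ob B ≫ (snocIso M.ob (A :: Δ) B).inv ≫ M.tm w
  | _, _, .lam (Γ := Γ) (A := A) v =>
    MonoidalClosed.curry
      ((β_ (tyObj M.ob A) (ctxObj M.ob Γ)).hom ≫ (snocIso M.ob Γ A).inv ≫ M.tm v)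
  | _, _, .app (A := A) (B := B) v w s =>
    splitHom M.ob s ≫ (M.tm v ⊗ₘ M.tm w) ≫ (β_ (tyObj M.ob (.hom A B)) (tyObj M.ob A)).hom ≫
      (ihom.ev (tyObj M.ob A)).app (tyObj M.ob B)
  | _, _, .dis v => M.tm v ≫ SemiCartesianMonoidalCategory.toUnit _

/-- The morphism `v₁ ⊗ … ⊗ vₙ`, preceded by the shuffling and splitting of the context. -/
def Interpretation.args (M : Interpretation S C) : {E : Ctx G} → {As : List (Ty G)} →
    Args S E As → (ctxObj M.ob E ⟶ ctxObj M.ob As)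
  | _, _, .nil => 𝟙 (𝟙_ C)
  | _, _, .snoc (As := As) (A := A) as v s =>
    splitHom M.ob s ≫ (M.args as ⊗ₘ M.tm v) ≫ (snocIso M.ob As A).inv

end

variable {V : Type x} [CommMonoid V] [CompleteLattice V] [EnrichedAffine V C]

/-- The `V`-equation `v =_q w` is satisfied by the interpretation `M`. -/
def Interpretation.Satisfies (M : Interpretation S C) {Γ : Ctx G} {A : Ty G} (v : Tm S Γ A) (q : V)
    (w : Tm S Γ A) : Prop :=
  q ≤ EnrichedAffine.hdist (M.tm v) (M.tm w)

/-- The interpretation `M` is a model of `T`: it satisfies all axioms. -/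
def Interpretation.IsModel (M : Interpretation S C) {B : Set V} (T : AffineTheory V B S) : Prop :=
  ∀ {Γ : Ctx G} {A : Ty G} (v w : Tm S Γ A) (q : V), T.Ax v q w → M.Satisfies v q w

end Semantics

end AffineLambda

-- Soundness is an induction on derivations. Its core is the substitution lemma `tm_subst`: the
-- morphism of `v[w/z]` is the morphism of `v` preceded by `plugHom`, which splits the context,
-- applies `w` to its part and inserts the result at the position of `z`. The equations of the
-- calculus then become identities of symmetric monoidal closed categories, and the two equations
-- for `dis` hold because `I` is terminal. Every other rule is an inequality of the enrichment. The
-- rule that infers `v =_q w` from all `r ≪ q` in `B` is sound because `q` is the least upper bound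
-- of these `r`.
--
-- Completeness comes from a model in which distances are exactly the provable ones. The syntactic
-- category is realised with closed terms of type `A ⊸ C`, modulo provable equality, as morphisms
-- from `A` to `C`; by β and η these correspond to terms `x : A ▷ v : C`. A closed function acts on
-- terms in every context (`ap`), and it is determined by its value on a variable, on `x ⊗ y`, on
-- `*`, or on any bracketing of these, according to its domain. These extensionality principles come
-- with inequalities of distances. Hence each axiom of an enriched affine category is checked by
-- evaluating both sides on a generic tuple, where only shuffles remain to be compared.
--
-- In this category the interpretation of a term, applied to the tuple of its context variables, is
-- the term itself (`act_synInterpretation_tm`), and application to that tuple preserves distances.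
-- So the distance of two interpretations is `synDist` (`hdist_synInterpretation`); in particular
-- the axioms hold. If `t =_q s` holds in all models, then `q ≤ synDist t s`. Each `r ≪ q` lies
-- below a finite join of provable labels, so the rules for finite joins, weakening and
-- approximation prove `t =_q s` (`thm_of_le_synDist`).
--
-- The unit is terminal because `dis(v) = v` for `v : I`, whereas `dis(v)` depends only on the
-- context of `v`; see `dis_unit_eq` and `unit_ext`.

namespace AffineLambda

-- Evaluation of shuffles

namespace Shuffle

variable {α : Type u}

@[simp] theorem swap_swap {Γ Δ E : List α} (s : Shuffle Γ Δ E) : s.swap.swap = s := by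
  induction s with
  | nil => rfl
  | left s ih => simp [swap, ih]
  | right s ih => simp [swap, ih]

@[simp] theorem swap_allLeft (Γ : List α) : (allLeft Γ).swap = allRight Γ := by
  induction Γ with
  | nil => rfl
  | cons A Γ ih => simp [swap, allLeft, allRight, ih]

@[simp] theorem swap_allRight (Γ : List α) : (allRight Γ).swap = allLeft Γ := by
  rw [← swap_allLeft, swap_swap]

/-- Substitution into a variable transports along the equality of contexts forced by such a shuffle;
this form lets that equality be eliminated. -/
theorem exists_eq_allRight {Δ F : List α} (t : Shuffle [] Δ F) :
    ∃ h : Δ = F, t = h ▸ allRight Δ := by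
  induction Δ generalizing F with
  | nil => cases t; exact ⟨rfl, rfl⟩
  | cons A Δ ih =>
    cases t with
    | right t =>
      obtain ⟨rfl, rfl⟩ := ih t
      exact ⟨rfl, rfl⟩

@[simp] theorem assoc_nil : assoc (nil (α := α)) nil = ⟨[], nil, nil⟩ := by
  simp [assoc]

@[simp] theorem assoc_right {A : α} {Γ Δ X Θ E : List α} (s : Shuffle Γ Δ X) (t : Shuffle X Θ E) :
    assoc s (right (A := A) t) =
      ⟨A :: (assoc s t).1, right (assoc s t).2.1, right (assoc s t).2.2⟩ := by
  rw [assoc]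

@[simp] theorem assoc_left_left {A : α} {Γ Δ X Θ E : List α} (s : Shuffle Γ Δ X)
    (t : Shuffle X Θ E) : assoc (left (A := A) s) (left t) =
      ⟨(assoc s t).1, (assoc s t).2.1, left (assoc s t).2.2⟩ := by
  rw [assoc]

@[simp] theorem assoc_right_left {A : α} {Γ Δ X Θ E : List α} (s : Shuffle Γ Δ X)
    (t : Shuffle X Θ E) : assoc (right (A := A) s) (left t) =
      ⟨A :: (assoc s t).1, left (assoc s t).2.1, right (assoc s t).2.2⟩ := by
  rw [assoc]

-- When one of the three contexts is empty, rebracketing changes nothing. This and its companions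
-- evaluate the shuffles that arise from substituting into variables and closed functions.
@[simp] theorem assoc_allLeft_right {Γ Δ E : List α} (s : Shuffle Γ Δ E) :
    assoc s (allLeft E) = ⟨Δ, allLeft Δ, s⟩ := by
  induction s with
  | nil => simp [allLeft]
  | left s ih => simp only [allLeft, assoc_left_left]; rw [ih]
  | right s ih => simp only [allLeft, assoc_right_left]; rw [ih]

@[simp] theorem assoc_allLeft {Γ Δ E : List α} (s : Shuffle Γ Δ E) :
    assoc (allLeft Γ) s = ⟨Δ, allRight Δ, s⟩ := by
  induction s with
  | nil => simp [allLeft, allRight]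
  | left s ih => simp only [allLeft, assoc_left_left]; rw [ih]
  | right s ih => simp only [allRight, assoc_right]; rw [ih]

@[simp] theorem assoc_allRight {Γ Δ E : List α} (s : Shuffle Γ Δ E) :
    assoc (allRight Γ) s = ⟨E, s, allRight E⟩ := by
  induction s with
  | nil => simp [allRight]
  | left s ih => simp only [allRight, assoc_right_left]; rw [ih]
  | right s ih => simp only [allRight, assoc_right]; rw [ih]

@[simp] theorem locate_allLeft {A : α} {Γ E : List α} (p : Pick A Γ E) :
    locate (allLeft E) p = .inl ⟨Γ, p, allLeft Γ⟩ := by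
  induction p with
  | here => simp [allLeft, locate]
  | there p ih => simp [allLeft, locate, ih]

@[simp] theorem locate_allRight {A : α} {Γ E : List α} (p : Pick A Γ E) :
    locate (allRight E) p = .inr ⟨Γ, p, allRight Γ⟩ := by
  induction p with
  | here => simp [allRight, locate]
  | there p ih => simp [allRight, locate, ih]

end Shuffle

-- Exchange of the last two tensor factors

section Coherence

variable {C : Type w} [Category.{v} C] [MonoidalCategory C] [SymmetricCategory C]

/-- The morphism exchanging the last two factors. -/
def exchHom (X A B : C) : (X ⊗ A) ⊗ B ⟶ (X ⊗ B) ⊗ A :=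
  (α_ X A B).hom ≫ X ◁ (β_ A B).hom ≫ (α_ X B A).inv

theorem exchHom_natural_base {X Y : C} (f : X ⟶ Y) (A B : C) :
    exchHom X A B ≫ f ▷ B ▷ A = f ▷ A ▷ B ≫ exchHom Y A B := by
  simp only [exchHom, Category.assoc, ← associator_inv_naturality_left, whisker_exchange_assoc,
    associator_naturality_left_assoc]

theorem exchHom_natural_left (X : C) {A A' : C} (g : A ⟶ A') (B : C) :
    (X ◁ g) ▷ B ≫ exchHom X A' B = exchHom X A B ≫ (X ⊗ B) ◁ g := by
  simp [exchHom, ← whiskerLeft_comp_assoc, -whiskerLeft_comp]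

theorem exchHom_natural_right (X A : C) {B B' : C} (g : B ⟶ B') :
    (X ⊗ A) ◁ g ≫ exchHom X A B' = exchHom X A B ≫ (X ◁ g) ▷ A := by
  simp [exchHom, ← whiskerLeft_comp_assoc, -whiskerLeft_comp]

theorem exchHom_exchHom (X A B : C) : exchHom X A B ≫ exchHom X B A = 𝟙 _ := by
  simp [exchHom, ← whiskerLeft_comp_assoc, -whiskerLeft_comp]

/-- This and the next identity let an exchange pass an associator. They are the coherence facts
needed when a variable is moved past a context that is itself split. -/
theorem exchHom_assoc_base (X Y A B : C) :
    exchHom (X ⊗ Y) A B ≫ (α_ X Y B).hom ▷ A ≫ (α_ X (Y ⊗ B) A).hom =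
      (α_ X Y A).hom ▷ B ≫ (α_ X (Y ⊗ A) B).hom ≫ X ◁ exchHom Y A B := by
  simp [exchHom]

theorem exchHom_assoc_left (X A B D : C) :
    (α_ X A B).hom ▷ D ≫ exchHom X (A ⊗ B) D =
      exchHom (X ⊗ A) B D ≫ exchHom X A D ▷ B ≫ (α_ (X ⊗ D) A B).hom := by
  simp [exchHom]

/-- The Yang–Baxter identity. Up to an associator, exchanging `A` and `B` is the braiding applied to
`A ⊗ B`, and this slides through the exchange of `A ⊗ B` with `D` by naturality. -/
theorem exchHom_hexagon (X A B D : C) :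
    exchHom X A B ▷ D ≫ exchHom (X ⊗ B) A D ≫ exchHom X B D ▷ A =
      exchHom (X ⊗ A) B D ≫ exchHom X A D ▷ B ≫ exchHom (X ⊗ D) A B := by
  have h (Y : C) : exchHom Y A B ≫ (α_ Y B A).hom = (α_ Y A B).hom ≫ Y ◁ (β_ A B).hom := by
    simp [exchHom]
  rw [← cancel_mono (α_ _ _ _).hom]
  simp only [Category.assoc, h, ← exchHom_assoc_left, ← reassoc_of% exchHom_assoc_left,
    ← exchHom_natural_left, ← comp_whiskerRight_assoc]

end Coherence

-- The substitution lemma for interpretations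

section Semantics

variable {G : Type u} {C : Type w} [Category.{v} C] [SemiCartesianMonoidalCategory C]
  [SymmetricCategory C] [MonoidalClosed C]

/-- The morphism inserting a variable into a context. -/
def insertHom (ob : G → C) {A : Ty G} : {Γ E : Ctx G} → Pick A Γ E →
    (ctxObj ob Γ ⊗ tyObj ob A ⟶ ctxObj ob E)
  | Γ, _, .here => (snocIso ob Γ A).inv
  | _, _, .there (B := B) (Γ := Γ) (E := E) p =>
    (snocIso ob Γ B).hom ▷ tyObj ob A ≫ (α_ _ _ _).hom ≫
      ctxObj ob Γ ◁ (β_ (tyObj ob B) (tyObj ob A)).hom ≫ (α_ _ _ _).inv ≫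
        insertHom ob p ▷ tyObj ob B ≫ (snocIso ob E B).inv

/-- The morphism that interprets the substitution of `m` for a variable. -/
def plugHom (ob : G → C) {A : Ty G} {Γ E Δ F : Ctx G} (p : Pick A Γ E) (t : Shuffle Γ Δ F)
    (m : ctxObj ob Δ ⟶ tyObj ob A) : ctxObj ob F ⟶ ctxObj ob E :=
  splitHom ob t ≫ ctxObj ob Γ ◁ m ≫ insertHom ob p

variable (ob : G → C)

theorem splitHom_allRight (Γ : Ctx G) :
    splitHom ob (Shuffle.allRight Γ) = (λ_ (ctxObj ob Γ)).inv := by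
  induction Γ with
  | nil => rfl
  | cons A Γ ih =>
    simp only [Shuffle.allRight, splitHom, ih, ctxObj]
    rw [← cancel_mono (λ_ _).hom]
    simp

theorem splitHom_allLeft (Γ : Ctx G) :
    splitHom ob (Shuffle.allLeft Γ) = (ρ_ (ctxObj ob Γ)).inv := by
  induction Γ with
  | nil => simp [Shuffle.allLeft, splitHom, unitors_inv_equal, ctxObj]
  | cons A Γ ih =>
    simp only [Shuffle.allLeft, splitHom, ih, ctxObj]
    rw [← cancel_mono (ρ_ _).hom]
    simp

theorem splitHom_swap {Γ Δ E : Ctx G} (s : Shuffle Γ Δ E) :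
    splitHom ob s.swap = splitHom ob s ≫ (β_ _ _).hom := by
  induction s with
  | nil =>
    simp only [Shuffle.swap, splitHom, ctxObj]
    simp [unitors_inv_equal]
  | left s ih =>
    simp only [Shuffle.swap, splitHom, ih]
    simp [← whiskerLeft_comp_assoc]
  | right s ih =>
    simp only [Shuffle.swap, splitHom, ih]
    simp

theorem splitHom_left {A : Ty G} {Γ Δ E : Ctx G} (s : Shuffle Γ Δ E) :
    splitHom ob (.left (A := A) s) = (snocIso ob E A).hom ≫ splitHom ob s ▷ tyObj ob A ≫
      exchHom _ _ _ ≫ (snocIso ob Γ A).inv ▷ ctxObj ob Δ := by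
  simp [splitHom, exchHom]

theorem splitHom_right {A : Ty G} {Γ Δ E : Ctx G} (s : Shuffle Γ Δ E) :
    splitHom ob (.right (A := A) s) = (snocIso ob E A).hom ≫ splitHom ob s ▷ tyObj ob A ≫
      (α_ _ _ _).hom ≫ ctxObj ob Γ ◁ (snocIso ob Δ A).inv := by
  simp [splitHom]

theorem insertHom_there {A B : Ty G} {Γ E : Ctx G} (p : Pick A Γ E) :
    insertHom ob (.there (B := B) p) = (snocIso ob Γ B).hom ▷ tyObj ob A ≫ exchHom _ _ _ ≫
      insertHom ob p ▷ tyObj ob B ≫ (snocIso ob E B).inv := by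
  simp [insertHom, exchHom]

/-- Splitting is coassociative, with `Shuffle.assoc` as the combinatorial counterpart of the
associator. The most recent variable belongs to `Θ`, `Γ` or `Δ`. The first case needs only
naturality and the pentagon, the other two need `exchHom_assoc_left` and `exchHom_assoc_base`. -/
theorem splitHom_assoc {Γ Δ X Θ E : Ctx G} (s : Shuffle Γ Δ X) (t : Shuffle X Θ E) :
    splitHom ob t ≫ splitHom ob s ▷ ctxObj ob Θ ≫ (α_ _ _ _).hom =
      splitHom ob (s.assoc t).2.2 ≫ ctxObj ob Γ ◁ splitHom ob (s.assoc t).2.1 := by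
  induction t generalizing Γ Δ with
  | nil =>
    cases s
    rw [Shuffle.assoc_nil]
    simp only [splitHom, ctxObj]
    monoidal
  | right t ih =>
    rename_i A X Θ E
    rw [Shuffle.assoc_right]
    trans (snocIso ob E A).hom ≫ (splitHom ob t ≫ splitHom ob s ▷ ctxObj ob Θ ≫
      (α_ _ _ _).hom) ▷ tyObj ob A ≫ (α_ _ _ _).hom ≫ ctxObj ob Γ ◁ (α_ _ _ _).hom ≫
        ctxObj ob Γ ◁ ctxObj ob Δ ◁ (snocIso ob Θ A).inv
    · simp only [splitHom_right, Category.assoc, whisker_exchange_assoc, comp_whiskerRight]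
      simp
    · rw [ih]
      simp [splitHom_right]
  | left t ih =>
    rename_i A X Θ E
    cases s with
    | left s =>
      rename_i Γ
      rw [Shuffle.assoc_left_left]
      trans (snocIso ob E A).hom ≫ (splitHom ob t ≫ splitHom ob s ▷ ctxObj ob Θ ≫
        (α_ _ _ _).hom) ▷ tyObj ob A ≫ exchHom _ _ _ ≫ (snocIso ob Γ A).inv ▷ _
      · simp only [splitHom_left, comp_whiskerRight, Category.assoc,
          inv_hom_whiskerRight_assoc,
          reassoc_of% exchHom_natural_base (splitHom ob s), reassoc_of% exchHom_assoc_left]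
        simp
      · rw [ih]
        simp only [splitHom_left, Category.assoc, ← whisker_exchange, comp_whiskerRight,
          reassoc_of% exchHom_natural_left]
    | right s =>
      rename_i Δ
      rw [Shuffle.assoc_right_left]
      trans (snocIso ob E A).hom ≫ (splitHom ob t ≫ splitHom ob s ▷ ctxObj ob Θ ≫
        (α_ _ _ _).hom) ▷ tyObj ob A ≫ (α_ _ _ _).hom ≫ ctxObj ob Γ ◁ (exchHom _ _ _ ≫
          (snocIso ob Δ A).inv ▷ _)
      · simp only [splitHom_left, splitHom_right, comp_whiskerRight, Category.assoc,
          inv_hom_whiskerRight_assoc, reassoc_of% exchHom_natural_base (splitHom ob s),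
          whiskerLeft_comp, ← reassoc_of% exchHom_assoc_base]
        simp
      · rw [ih]
        simp [splitHom_left, splitHom_right]

/-- The semantic counterpart of `Shuffle.locate`: inserting and then splitting equals splitting and
then inserting into the half that owns the variable. In the inductive step the inserted variable and
the last variable of the context may lie in the same half or in different halves. If both lie in the
left half, the order of the exchanges matters and `exchHom_hexagon` is used. -/
theorem insertHom_splitHom {A : Ty G} {Γ₁ Γ₂ E Γ : Ctx G} (s : Shuffle Γ₁ Γ₂ E) (p : Pick A Γ E) :
    insertHom ob p ≫ splitHom ob s = match s.locate p with
    | .inl ⟨_, p', s'⟩ => splitHom ob s' ▷ tyObj ob A ≫ exchHom _ _ _ ≫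
        insertHom ob p' ▷ ctxObj ob Γ₂
    | .inr ⟨_, p', s'⟩ => splitHom ob s' ▷ tyObj ob A ≫ (α_ _ _ _).hom ≫
        ctxObj ob Γ₁ ◁ insertHom ob p' := by
  induction s generalizing Γ with
  | nil => cases p
  | left s ih =>
    rename_i B Γ₁ Γ₂ E
    cases p with
    | here => simp [Shuffle.locate, insertHom, splitHom_left]
    | there p =>
      rename_i Γ
      rw [Shuffle.locate]
      trans (snocIso ob Γ B).hom ▷ tyObj ob A ≫ exchHom _ _ _ ≫
          (insertHom ob p ≫ splitHom ob s) ▷ tyObj ob B ≫ exchHom _ _ _ ≫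
              (snocIso ob Γ₁ B).inv ▷ ctxObj ob Γ₂
      · simp [insertHom_there, splitHom_left]
      rw [ih]
      rcases s.locate p with ⟨Γ₁', p', s'⟩ | ⟨Γ₂', p', s'⟩
      · simp only [insertHom_there, splitHom_left, comp_whiskerRight, Category.assoc]
        have h : (snocIso ob Γ₁' B).inv ▷ tyObj ob A ▷ ctxObj ob Γ₂ ≫
            (snocIso ob Γ₁' B).hom ▷ tyObj ob A ▷ ctxObj ob Γ₂ = 𝟙 _ := by
          simp [← comp_whiskerRight]
        simp only [reassoc_of% exchHom_natural_base (splitHom ob s'),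
          ← reassoc_of% exchHom_natural_base (snocIso ob Γ₁' B).inv, reassoc_of% h,
          ← reassoc_of% exchHom_natural_base (insertHom ob p'), ← reassoc_of% exchHom_hexagon]
      · simp only [splitHom_left, comp_whiskerRight, Category.assoc]
        simp only [reassoc_of% exchHom_natural_base, reassoc_of% exchHom_natural_left,
          reassoc_of% exchHom_assoc_left, reassoc_of% exchHom_exchHom, whisker_exchange,
          associator_naturality_left_assoc]
  | right s ih =>
    rename_i B Γ₁ Γ₂ E
    cases p with
    | here => simp [Shuffle.locate, insertHom, splitHom_right]
    | there p =>
      rename_i Γ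
      rw [Shuffle.locate]
      trans (snocIso ob Γ B).hom ▷ tyObj ob A ≫ exchHom _ _ _ ≫
          (insertHom ob p ≫ splitHom ob s) ▷ tyObj ob B ≫ (α_ _ _ _).hom ≫
            ctxObj ob Γ₁ ◁ (snocIso ob Γ₂ B).inv
      · simp [insertHom_there, splitHom_right]
      rw [ih]
      rcases s.locate p with ⟨Γ₁', p', s'⟩ | ⟨Γ₂', p', s'⟩
      · simp only [splitHom_right, comp_whiskerRight, Category.assoc]
        simp only [reassoc_of% exchHom_natural_base, reassoc_of% exchHom_natural_left,
          reassoc_of% exchHom_assoc_left, associator_naturality_left_assoc, ← whisker_exchange]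
      · simp only [insertHom_there, splitHom_right, comp_whiskerRight, Category.assoc]
        simp only [reassoc_of% exchHom_natural_base]
        have h := reassoc_of% exchHom_assoc_base (ctxObj ob Γ₁) (ctxObj ob Γ₂') (tyObj ob B)
          (tyObj ob A)
        simp [h]

/-- Substitution under a binder leaves the bound variable, which is last in the context, untouched:
the two exchanges past it cancel. -/
theorem plugHom_there_left {A B : Ty G} {Γ E Δ F : Ctx G} (p : Pick A Γ E) (t : Shuffle Γ Δ F)
    (m : ctxObj ob Δ ⟶ tyObj ob A) :
    plugHom ob (.there (B := B) p) (.left t) m = (snocIso ob F B).hom ≫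
      plugHom ob p t m ▷ tyObj ob B ≫ (snocIso ob E B).inv := by
  have h := whisker_exchange ((snocIso ob Γ B).inv) m
  simp only [plugHom, splitHom_left, insertHom_there, Category.assoc, ← whisker_exchange_assoc,
    inv_hom_whiskerRight_assoc, ← reassoc_of% exchHom_natural_left,
    reassoc_of% exchHom_exchHom, comp_whiskerRight]

/-- This and `plugHom_splitHom_inr` mirror the two branches of `Tm.subst` at a binary term former:
the shuffles are those chosen there, and the proof combines `insertHom_splitHom` with
`splitHom_assoc`. Here the plugged context has to travel past `Γ₂`, hence the swaps. -/
theorem plugHom_splitHom_inl {A : Ty G} {Γ₁ Γ₂ E Γ Γ₁' Δ F : Ctx G} {s : Shuffle Γ₁ Γ₂ E}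
    {p : Pick A Γ E} {p' : Pick A Γ₁' Γ₁} {s' : Shuffle Γ₁' Γ₂ Γ}
    (h : s.locate p = .inl ⟨Γ₁', p', s'⟩) (t : Shuffle Γ Δ F)
    (m : ctxObj ob Δ ⟶ tyObj ob A) :
    splitHom ob (s'.swap.assoc t).2.2.swap ≫
      plugHom ob p' (s'.swap.assoc t).2.1 m ▷ ctxObj ob Γ₂ = plugHom ob p t m ≫ splitHom ob s := by
  have h1 := insertHom_splitHom ob s p
  simp only [h] at h1
  have h2 := splitHom_assoc ob s'.swap t
  have h3 (X Y Z : C) : (β_ X Y).hom ▷ Z ≫ (α_ Y X Z).hom ≫ (β_ Y (X ⊗ Z)).hom =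
      exchHom X Y Z := by
    simp [exchHom, ← comp_whiskerRight_assoc]
  simp only [splitHom_swap, comp_whiskerRight, Category.assoc] at h2
  rw [splitHom_swap, Category.assoc, ← BraidedCategory.braiding_naturality_right]
  simp only [plugHom, Category.assoc, h1, whiskerLeft_comp, ← reassoc_of% h2]
  simp only [BraidedCategory.braiding_naturality_right,
    BraidedCategory.braiding_naturality_right_assoc, reassoc_of% h3,
    whisker_exchange_assoc, reassoc_of% exchHom_natural_right]

theorem plugHom_splitHom_inr {A : Ty G} {Γ₁ Γ₂ E Γ Γ₂' Δ F : Ctx G} {s : Shuffle Γ₁ Γ₂ E}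
    {p : Pick A Γ E} {p' : Pick A Γ₂' Γ₂} {s' : Shuffle Γ₁ Γ₂' Γ}
    (h : s.locate p = .inr ⟨Γ₂', p', s'⟩) (t : Shuffle Γ Δ F)
    (m : ctxObj ob Δ ⟶ tyObj ob A) :
    splitHom ob (s'.assoc t).2.2 ≫
      ctxObj ob Γ₁ ◁ plugHom ob p' (s'.assoc t).2.1 m = plugHom ob p t m ≫ splitHom ob s := by
  have h1 := insertHom_splitHom ob s p
  simp only [h] at h1
  have h2 := splitHom_assoc ob s' t
  simp only [plugHom, Category.assoc, h1, whiskerLeft_comp, ← reassoc_of% h2,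
    whisker_exchange_assoc]
  simp

theorem plugHom_tensorHom_inl {A : Ty G} {Γ₁ Γ₂ E Γ Γ₁' Δ F : Ctx G} {s : Shuffle Γ₁ Γ₂ E}
    {p : Pick A Γ E} {p' : Pick A Γ₁' Γ₁} {s' : Shuffle Γ₁' Γ₂ Γ}
    (h : s.locate p = .inl ⟨Γ₁', p', s'⟩) (t : Shuffle Γ Δ F)
    (m : ctxObj ob Δ ⟶ tyObj ob A) {X Y Z : C} (f : ctxObj ob Γ₁ ⟶ X) (g : ctxObj ob Γ₂ ⟶ Y)
    (k : X ⊗ Y ⟶ Z) :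
    splitHom ob (s'.swap.assoc t).2.2.swap ≫
      ((plugHom ob p' (s'.swap.assoc t).2.1 m ≫ f) ⊗ₘ g) ≫ k =
        plugHom ob p t m ≫ splitHom ob s ≫ (f ⊗ₘ g) ≫ k := by
  have h1 := plugHom_splitHom_inl ob h t m
  simp only [← reassoc_of% h1, comp_whiskerRight, MonoidalCategory.tensorHom_def, Category.assoc]

theorem plugHom_tensorHom_inr {A : Ty G} {Γ₁ Γ₂ E Γ Γ₂' Δ F : Ctx G} {s : Shuffle Γ₁ Γ₂ E}
    {p : Pick A Γ E} {p' : Pick A Γ₂' Γ₂} {s' : Shuffle Γ₁ Γ₂' Γ}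
    (h : s.locate p = .inr ⟨Γ₂', p', s'⟩) (t : Shuffle Γ Δ F)
    (m : ctxObj ob Δ ⟶ tyObj ob A) {X Y Z : C} (f : ctxObj ob Γ₁ ⟶ X) (g : ctxObj ob Γ₂ ⟶ Y)
    (k : X ⊗ Y ⟶ Z) :
    splitHom ob (s'.assoc t).2.2 ≫
      (f ⊗ₘ (plugHom ob p' (s'.assoc t).2.1 m ≫ g)) ≫ k =
        plugHom ob p t m ≫ splitHom ob s ≫ (f ⊗ₘ g) ≫ k := by
  have h1 := plugHom_splitHom_inr ob h t m
  simp only [← reassoc_of% h1, whiskerLeft_comp, MonoidalCategory.tensorHom_def', Category.assoc]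

theorem plugHom_pm_inr {A : Ty G} {Γ₁ Γ₂ E Γ Γ₂' Δ F : Ctx G} {s : Shuffle Γ₁ Γ₂ E}
    {p : Pick A Γ E} {p' : Pick A Γ₂' Γ₂} {s' : Shuffle Γ₁ Γ₂' Γ}
    (h : s.locate p = .inr ⟨Γ₂', p', s'⟩) (t : Shuffle Γ Δ F)
    (m : ctxObj ob Δ ⟶ tyObj ob A) {X Y Z : C} (f : ctxObj ob Γ₁ ⟶ X ⊗ Y)
    (k : (ctxObj ob Γ₂ ⊗ X) ⊗ Y ⟶ Z) :
    splitHom ob (s'.assoc t).2.2 ≫ f ▷ _ ≫ (β_ _ _).hom ≫ (α_ _ _ _).inv ≫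
      plugHom ob p' (s'.assoc t).2.1 m ▷ X ▷ Y ≫ k =
        plugHom ob p t m ≫ splitHom ob s ≫ f ▷ _ ≫ (β_ _ _).hom ≫ (α_ _ _ _).inv ≫ k := by
  have h1 := plugHom_splitHom_inr ob h t m
  simp only [← reassoc_of% h1, whisker_exchange_assoc, ← associator_inv_naturality_left_assoc,
    BraidedCategory.braiding_naturality_right_assoc]

variable {S : Signature.{u, u'} G} (M : Interpretation S C)

mutual

theorem tm_subst {A : Ty G} {Δ : Ctx G} (w : Tm S Δ A) : {E Γ F : Ctx G} → {B : Ty G} →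
    (v : Tm S E B) → (p : Pick A Γ E) → (t : Shuffle Γ Δ F) →
      M.tm (v.subst p w t) = plugHom M.ob p t (M.tm w) ≫ M.tm v
  | _, _, _, _, .var, .here, t => by
    obtain ⟨rfl, rfl⟩ := t.exists_eq_allRight
    simp only [Tm.subst, Interpretation.tm, plugHom, splitHom_allRight, insertHom, snocIso, ctxObj]
    simp
  | _, _, _, _, .op f as, p, t => by
    simp only [Tm.subst, Interpretation.tm, args_subst w as p t, Category.assoc]
  | _, _, _, _, .unitE v₁ v₂ s, p, t => by
    rw [Tm.subst]
    rcases h : s.locate p with ⟨Γ', p', s'⟩ | ⟨Γ', p', s'⟩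
    · have h1 := plugHom_splitHom_inl M.ob h t (M.tm w)
      simp only [Interpretation.tm, tm_subst w v₁, ← reassoc_of% h1, comp_whiskerRight,
        Category.assoc]
    · have h1 := plugHom_splitHom_inr M.ob h t (M.tm w)
      simp only [Interpretation.tm, tm_subst w v₂, ← reassoc_of% h1, whisker_exchange_assoc]
      dsimp only [tyObj]
      simp only [leftUnitor_naturality_assoc]
  | _, _, _, _, .tensor v₁ v₂ s, p, t => by
    rw [Tm.subst]
    rcases h : s.locate p with ⟨Γ', p', s'⟩ | ⟨Γ', p', s'⟩
    · have h1 := plugHom_tensorHom_inl M.ob h t (M.tm w) (M.tm v₁) (M.tm v₂) (𝟙 _)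
      simp only [Category.comp_id] at h1
      simp only [Interpretation.tm, tm_subst w v₁]
      exact h1
    · have h1 := plugHom_tensorHom_inr M.ob h t (M.tm w) (M.tm v₁) (M.tm v₂) (𝟙 _)
      simp only [Category.comp_id] at h1
      simp only [Interpretation.tm, tm_subst w v₂]
      exact h1
  | _, _, _, _, .pm v₁ v₂ s, p, t => by
    rw [Tm.subst]
    rcases h : s.locate p with ⟨Γ', p', s'⟩ | ⟨Γ', p', s'⟩
    · have h1 := plugHom_splitHom_inl M.ob h t (M.tm w)
      simp only [Interpretation.tm, tm_subst w v₁, ← reassoc_of% h1, comp_whiskerRight,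
        Category.assoc]
    · simp only [Interpretation.tm, tm_subst w v₂, plugHom_there_left, comp_whiskerRight,
        Category.assoc, inv_hom_whiskerRight_assoc, Iso.inv_hom_id_assoc]
      exact plugHom_pm_inr M.ob h t (M.tm w) (M.tm v₁) _
  | _, _, _, _, .lam v, p, t => by
    simp only [Tm.subst, Interpretation.tm, tm_subst w v, plugHom_there_left, Category.assoc,
      Iso.inv_hom_id_assoc, ← BraidedCategory.braiding_naturality_right_assoc]
    exact MonoidalClosed.curry_natural_left _ _
  | _, _, _, _, .app v₁ v₂ s, p, t => by
    rw [Tm.subst]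
    rcases h : s.locate p with ⟨Γ', p', s'⟩ | ⟨Γ', p', s'⟩
    · simp only [Interpretation.tm, tm_subst w v₁]
      exact plugHom_tensorHom_inl M.ob h t (M.tm w) _ _ _
    · simp only [Interpretation.tm, tm_subst w v₂]
      exact plugHom_tensorHom_inr M.ob h t (M.tm w) _ _ _
  | _, _, _, _, .dis v, p, t => by
    simp only [Tm.subst, Interpretation.tm, tm_subst w v]
    exact SemiCartesianMonoidalCategory.toUnit_unique _ _

theorem args_subst {A : Ty G} {Δ : Ctx G} (w : Tm S Δ A) : {E Γ F : Ctx G} → {As : List (Ty G)} →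
    (as : Args S E As) → (p : Pick A Γ E) → (t : Shuffle Γ Δ F) →
      M.args (as.subst p w t) = plugHom M.ob p t (M.tm w) ≫ M.args as
  | _, _, _, _, .snoc as v s, p, t => by
    rw [Args.subst]
    rcases h : s.locate p with ⟨Γ', p', s'⟩ | ⟨Γ', p', s'⟩
    · simp only [Interpretation.args, args_subst w as]
      exact plugHom_tensorHom_inl M.ob h t (M.tm w) _ _ _
    · simp only [Interpretation.args, tm_subst w v]
      exact plugHom_tensorHom_inr M.ob h t (M.tm w) _ _ _

end

end Semantics

-- Braiding identities for pattern matching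

section Coherence

variable {C : Type w} [Category.{v} C] [MonoidalCategory C] [SymmetricCategory C]

/-- The interpretation of `pm` moves `A ⊗ B` past the context in one block, whereas the two
substitutions of the β-rule insert the components one at a time. This compares the two. -/
theorem braiding_eq_exchHom (A B D : C) :
    (α_ A B D).inv ≫ (β_ (A ⊗ B) D).hom ≫ (α_ D A B).inv =
      (β_ A (B ⊗ D)).hom ≫ (β_ B D).hom ▷ A ≫ exchHom D B A := by
  rw [← BraidedCategory.braiding_naturality_right_assoc]
  simp [exchHom, ← whiskerLeft_comp_assoc, -whiskerLeft_comp]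

/-- For the commuting conversion of `pm`, with `D` the context around the hole: carrying `D` past `X
⊗ Y` and back leaves only the exchange of `X` and `Y`. -/
theorem braiding_rotate (D X Y : C) :
    (β_ D (X ⊗ Y)).hom ≫ (α_ X Y D).hom ≫ (β_ X (Y ⊗ D)).hom ≫ (β_ Y D).hom ▷ X ≫
      (α_ D Y X).hom = D ◁ (β_ X Y).hom := by
  have h : (α_ X Y D).hom ≫ (β_ X (Y ⊗ D)).hom =
      (β_ X Y).hom ▷ D ≫ (α_ Y X D).hom ≫ Y ◁ (β_ X D).hom ≫ (α_ Y D X).inv := by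
    simp
  rw [reassoc_of% h, ← BraidedCategory.braiding_naturality_right_assoc]
  have h1 : Y ◁ (β_ D X).hom ≫ Y ◁ (β_ X D).hom = 𝟙 _ := by simp [← whiskerLeft_comp]
  have h2 : (β_ D Y).hom ▷ X ≫ (β_ Y D).hom ▷ X = 𝟙 _ := by simp [← comp_whiskerRight]
  simp [reassoc_of% h1, reassoc_of% h2]

end Coherence

-- Soundness

section Soundness

variable {G : Type u} {C : Type w} [Category.{v} C] [SemiCartesianMonoidalCategory C]
  [SymmetricCategory C] [MonoidalClosed C] {S : Signature.{u, u'} G} (M : Interpretation S C)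

theorem splitHom_right_allLeft (ob : G → C) (Γ : Ctx G) (A : Ty G) :
    splitHom ob (.right (A := A) (.allLeft Γ)) = (snocIso ob Γ A).hom := by
  rw [splitHom_right, splitHom_allLeft]
  change (snocIso ob Γ A).hom ≫ (ρ_ (ctxObj ob Γ)).inv ▷ tyObj ob A ≫
    (α_ (ctxObj ob Γ) (𝟙_ C) (tyObj ob A)).hom ≫ ctxObj ob Γ ◁ (λ_ (tyObj ob A)).hom =
      (snocIso ob Γ A).hom
  simp

theorem splitHom_right_right_allLeft (ob : G → C) (Γ : Ctx G) (A B : Ty G) :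
    splitHom ob (.right (A := B) (.right (A := A) (.allLeft Γ))) =
      (snocIso ob (A :: Γ) B).hom ≫ (snocIso ob Γ A).hom ▷ tyObj ob B ≫ (α_ _ _ _).hom := by
  rw [splitHom_right, splitHom_right_allLeft]
  change (snocIso ob (A :: Γ) B).hom ≫ (snocIso ob Γ A).hom ▷ tyObj ob B ≫
    (α_ (ctxObj ob Γ) (tyObj ob A) (tyObj ob B)).hom ≫
      ctxObj ob Γ ◁ 𝟙 (tyObj ob A ⊗ tyObj ob B) = _
  simp only [whiskerLeft_id, Category.comp_id]

theorem tm_tensor_var_var (M : Interpretation S C) (A B : Ty G) :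
    M.tm (.tensor .var .var (.right (.left .nil)) : Tm S [B, A] (.tensor A B)) =
      𝟙 (tyObj M.ob A ⊗ tyObj M.ob B) := by
  have h : splitHom M.ob (.right (.allLeft [A])) = 𝟙 (tyObj M.ob A ⊗ tyObj M.ob B) :=
    splitHom_right_allLeft M.ob [A] B
  have h' : 𝟙 (tyObj M.ob A) ⊗ₘ 𝟙 (tyObj M.ob B) = 𝟙 (tyObj M.ob A ⊗ tyObj M.ob B) := by simp
  exact (congrArg₂ CategoryStruct.comp h h').trans (Category.comp_id _)

theorem tm_eq_of_eqn_tensor_beta (ob : G → C) {Γ Δ Θ F E : Ctx G} {A B : Ty G}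
    (v : ctxObj ob Γ ⟶ tyObj ob A) (w : ctxObj ob Δ ⟶ tyObj ob B) {X : C}
    (u : ctxObj ob (B :: A :: Θ) ⟶ X) (s : Shuffle Γ Δ F) (t : Shuffle F Θ E) :
    splitHom ob t ≫ (splitHom ob s ≫ (v ⊗ₘ w)) ▷ ctxObj ob Θ ≫ (β_ _ _).hom ≫
      (α_ _ _ _).inv ≫ (snocIso ob Θ A).inv ▷ tyObj ob B ≫ (snocIso ob (A :: Θ) B).inv ≫ u =
    plugHom ob .here (s.assoc t).2.2.swap v ≫ plugHom ob .here (.left (s.assoc t).2.1.swap) w ≫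
      u := by
  have h := splitHom_assoc ob s t
  rw [← cancel_mono (α_ _ _ _).inv] at h
  simp only [Category.assoc, Iso.hom_inv_id, Category.comp_id] at h
  simp only [plugHom, insertHom, splitHom_left, splitHom_swap, comp_whiskerRight, Category.assoc,
    Iso.inv_hom_id_assoc, reassoc_of% h]
  have hw : (β_ (ctxObj ob Δ) (ctxObj ob Θ)).hom ▷ tyObj ob A ≫ (ctxObj ob Θ ◁ w) ▷ tyObj ob A =
      (w ▷ ctxObj ob Θ) ▷ tyObj ob A ≫ (β_ (tyObj ob B) (ctxObj ob Θ)).hom ▷ tyObj ob A := by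
    rw [← comp_whiskerRight, ← BraidedCategory.braiding_naturality_left, comp_whiskerRight]
  have hc := braiding_eq_exchHom (tyObj ob A) (tyObj ob B) (ctxObj ob Θ)
  have hv : (α_ (ctxObj ob Γ) (ctxObj ob Δ) (ctxObj ob Θ)).inv ≫ (v ⊗ₘ w) ▷ ctxObj ob Θ =
      v ▷ _ ≫ tyObj ob A ◁ (w ▷ ctxObj ob Θ) ≫ (α_ _ _ _).inv := by
    simp [MonoidalCategory.tensorHom_def]
  simp only [reassoc_of% hv, reassoc_of% hc]
  rw [← BraidedCategory.braiding_naturality_left_assoc]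
  rw [← whisker_exchange_assoc (snocIso ob Θ A).inv w, ← reassoc_of% exchHom_natural_left,
    reassoc_of% hw, BraidedCategory.braiding_naturality_right_assoc, whisker_exchange_assoc,
    BraidedCategory.braiding_naturality_right_assoc]

/-- The interpretation `m` of `x ⊗ y` is a parameter because its source and target agree with `tyObj
ob A ⊗ tyObj ob B` only after unfolding. The computation is done with unfolded objects and an
arbitrary insertion `j`, and transferred by definitional equality. -/
theorem tm_eq_of_eqn_tensor_eta (ob : G → C) {Γ Δ X E : Ctx G} {A B : Ty G}
    (v : ctxObj ob Γ ⟶ tyObj ob (.tensor A B)) {Y : C} (u : ctxObj ob X ⟶ Y)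
    (p : Pick (.tensor A B) Δ X) (s : Shuffle Γ Δ E)
    (m : ctxObj ob [B, A] ⟶ tyObj ob (.tensor A B)) (hm : m = 𝟙 (tyObj ob A ⊗ tyObj ob B)) :
    splitHom ob s ≫ v ▷ ctxObj ob Δ ≫ (β_ (tyObj ob A ⊗ tyObj ob B) _).hom ≫ (α_ _ _ _).inv ≫
      (snocIso ob Δ A).inv ▷ tyObj ob B ≫ (snocIso ob (A :: Δ) B).inv ≫
        plugHom ob p (.right (.right (.allLeft Δ))) m ≫ u =
    plugHom ob p s.swap v ≫ u := by
  subst hm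
  have h (j : ctxObj ob Δ ⊗ (tyObj ob A ⊗ tyObj ob B) ⟶ ctxObj ob X)
      (v : ctxObj ob Γ ⟶ tyObj ob A ⊗ tyObj ob B) :
      splitHom ob s ≫ v ▷ ctxObj ob Δ ≫ (β_ (tyObj ob A ⊗ tyObj ob B) _).hom ≫ (α_ _ _ _).inv ≫
        (snocIso ob Δ A).inv ▷ tyObj ob B ≫ (snocIso ob (A :: Δ) B).inv ≫
          (((snocIso ob (A :: Δ) B).hom ≫ (snocIso ob Δ A).hom ▷ tyObj ob B ≫
            (α_ _ (tyObj ob A) (tyObj ob B)).hom) ≫ ctxObj ob Δ ◁ 𝟙 _ ≫ j) ≫ u =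
      ((splitHom ob s ≫ (β_ _ _).hom) ≫ ctxObj ob Δ ◁ v ≫ j) ≫ u := by
    simp only [Category.assoc, Iso.inv_hom_id_assoc, inv_hom_whiskerRight_assoc,
      BraidedCategory.braiding_naturality_left_assoc, whiskerLeft_id, Category.id_comp]
  have h' := h (insertHom ob p) v
  rw [← splitHom_right_right_allLeft, ← splitHom_swap] at h'
  exact h'

theorem tm_eq_of_eqn_unit_eta (ob : G → C) {Γ Δ X E : Ctx G} (v : ctxObj ob Γ ⟶ 𝟙_ C) {Y : C}
    (w : ctxObj ob X ⟶ Y) (p : Pick Ty.unit Δ X) (s : Shuffle Γ Δ E) :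
    splitHom ob s ≫ v ▷ ctxObj ob Δ ≫ (λ_ (ctxObj ob Δ)).hom ≫
      plugHom ob p (.allLeft Δ) (𝟙 (𝟙_ C)) ≫ w = plugHom ob p s.swap v ≫ w := by
  have h1 : v ▷ ctxObj ob Δ ≫ (λ_ (ctxObj ob Δ)).hom ≫ (ρ_ (ctxObj ob Δ)).inv =
      (β_ _ _).hom ≫ ctxObj ob Δ ◁ v := by
    rw [← BraidedCategory.braiding_naturality_left, braiding_tensorUnit_left]
  have h (j : ctxObj ob Δ ⊗ 𝟙_ C ⟶ ctxObj ob X) :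
      splitHom ob s ≫ v ▷ ctxObj ob Δ ≫ (λ_ (ctxObj ob Δ)).hom ≫
        ((ρ_ (ctxObj ob Δ)).inv ≫ ctxObj ob Δ ◁ 𝟙 _ ≫ j) ≫ w =
      ((splitHom ob s ≫ (β_ _ _).hom) ≫ ctxObj ob Δ ◁ v ≫ j) ≫ w := by
    simp only [Category.assoc, whiskerLeft_id, Category.id_comp, reassoc_of% h1]
  have h' := h (insertHom ob p)
  rw [← splitHom_allLeft, ← splitHom_swap] at h'
  exact h'

theorem tm_eq_of_eqn_hom_beta (ob : G → C) {Γ Δ E : Ctx G} {A : Ty G} {Y : C}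
    (v : ctxObj ob (A :: Γ) ⟶ Y) (w : ctxObj ob Δ ⟶ tyObj ob A) (s : Shuffle Γ Δ E) :
    splitHom ob s ≫ (MonoidalClosed.curry ((β_ (tyObj ob A) (ctxObj ob Γ)).hom ≫
      (snocIso ob Γ A).inv ≫ v) ⊗ₘ w) ≫ (β_ _ _).hom ≫ (ihom.ev (tyObj ob A)).app Y =
    plugHom ob .here s w ≫ v := by
  simp only [plugHom, insertHom, MonoidalCategory.tensorHom_def', Category.assoc,
    BraidedCategory.braiding_naturality_left_assoc, ← MonoidalClosed.uncurry_eq,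
    MonoidalClosed.uncurry_curry, SymmetricCategory.symmetry_assoc]

theorem tm_eq_of_eqn_hom_eta (ob : G → C) {Γ : Ctx G} {A : Ty G} {Y : C}
    (v : ctxObj ob Γ ⟶ (ihom (tyObj ob A)).obj Y)
    (σ : ctxObj ob (A :: Γ) ⟶ ctxObj ob Γ ⊗ tyObj ob A) (hσ : σ = (snocIso ob Γ A).hom) :
    MonoidalClosed.curry ((β_ (tyObj ob A) (ctxObj ob Γ)).hom ≫ (snocIso ob Γ A).inv ≫
      σ ≫ (v ⊗ₘ 𝟙 (tyObj ob A)) ≫ (β_ _ _).hom ≫ (ihom.ev (tyObj ob A)).app Y) = v := by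
  subst hσ
  simp [← MonoidalClosed.uncurry_eq]

theorem tm_eq_of_eqn_unit_comm (ob : G → C) {Γ Δ Θ X F E : Ctx G} {A : Ty G}
    (v : ctxObj ob Γ ⟶ 𝟙_ C) (w : ctxObj ob Δ ⟶ tyObj ob A) (s : Shuffle Γ Δ F) {Y : C}
    (u : ctxObj ob X ⟶ Y) (p : Pick A Θ X) (t : Shuffle Θ F E) :
    plugHom ob p t (splitHom ob s ≫ v ▷ ctxObj ob Δ ≫ (λ_ (ctxObj ob Δ)).hom ≫ w) ≫ u =
    splitHom ob (s.assoc t.swap).2.2 ≫ v ▷ ctxObj ob (s.assoc t.swap).1 ≫ (λ_ _).hom ≫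
      plugHom ob p (s.assoc t.swap).2.1.swap w ≫ u := by
  have h := splitHom_assoc ob s t.swap
  simp only [splitHom_swap, Category.assoc] at h
  simp only [plugHom, splitHom_swap, Category.assoc]
  rw [← leftUnitor_naturality_assoc (splitHom ob (s.assoc t.swap).2.1), ← whisker_exchange_assoc,
    ← reassoc_of% h, ← associator_naturality_left_assoc,
    ← BraidedCategory.braiding_naturality_right_assoc,
    ← BraidedCategory.braiding_naturality_right_assoc]
  have h1 : (α_ (𝟙_ C) (ctxObj ob Δ) (ctxObj ob Θ)).hom ≫ (λ_ _).hom =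
    (λ_ (ctxObj ob Δ)).hom ▷ ctxObj ob Θ := by simp
  simp only [reassoc_of% h1, ← BraidedCategory.braiding_naturality_right_assoc,
    SymmetricCategory.symmetry_assoc, whiskerLeft_comp, Category.assoc]

theorem tm_eq_of_eqn_tensor_comm (ob : G → C) {Γ Δ Θ X F E : Ctx G} {A B D : Ty G}
    (v : ctxObj ob Γ ⟶ tyObj ob A ⊗ tyObj ob B) (w : ctxObj ob (B :: A :: Δ) ⟶ tyObj ob D)
    (s : Shuffle Γ Δ F) {Y : C} (u : ctxObj ob X ⟶ Y) (p : Pick D Θ X) (t : Shuffle Θ F E) :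
    plugHom ob p t (splitHom ob s ≫ v ▷ ctxObj ob Δ ≫ (β_ _ _).hom ≫ (α_ _ _ _).inv ≫
      (snocIso ob Δ A).inv ▷ tyObj ob B ≫ (snocIso ob (A :: Δ) B).inv ≫ w) ≫ u =
    splitHom ob (s.assoc t.swap).2.2 ≫ v ▷ ctxObj ob (s.assoc t.swap).1 ≫
      (β_ _ _).hom ≫ (α_ _ _ _).inv ≫ (snocIso ob _ A).inv ▷ tyObj ob B ≫
        (snocIso ob (A :: _) B).inv ≫
          plugHom ob p (.right (.right (s.assoc t.swap).2.1.swap)) w ≫ u := by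
  have h := splitHom_assoc ob s t.swap
  simp only [splitHom_swap, Category.assoc] at h
  have h1 := braiding_rotate (ctxObj ob Θ) (tyObj ob A ⊗ tyObj ob B) (ctxObj ob Δ)
  rw [← cancel_mono (α_ _ _ _).inv] at h1
  simp only [Category.assoc, Iso.hom_inv_id, Category.comp_id] at h1
  simp only [plugHom, splitHom_right, splitHom_swap, Category.assoc, comp_whiskerRight,
    inv_hom_whiskerRight_assoc, Iso.inv_hom_id_assoc]
  rw [← associator_inv_naturality_left_assoc, ← associator_inv_naturality_left_assoc,
    ← BraidedCategory.braiding_naturality_right_assoc _ (splitHom ob (s.assoc t.swap).2.1),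
    ← whisker_exchange_assoc,
    ← reassoc_of% h, ← associator_naturality_left_assoc,
    ← BraidedCategory.braiding_naturality_right_assoc,
    ← BraidedCategory.braiding_naturality_right_assoc, reassoc_of% h1]
  simp

theorem tm_eq_of_eqn {Γ : Ctx G} {A : Ty G} {v w : Tm S Γ A} (h : Eqn v w) : M.tm v = M.tm w := by
  induction h with
  | tensor_beta v w u s t =>
    simp only [tm_subst]
    exact tm_eq_of_eqn_tensor_beta M.ob (M.tm v) (M.tm w) (M.tm u) s t
  | tensor_eta v u p s =>
    rw [Interpretation.tm, tm_subst, tm_subst]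
    exact tm_eq_of_eqn_tensor_eta M.ob (M.tm v) (M.tm u) p s _ (tm_tensor_var_var M _ _)
  | unit_beta v =>
    rename_i Γ A
    have h : (λ_ (ctxObj M.ob Γ)).inv ≫ 𝟙 (𝟙_ C) ▷ ctxObj M.ob Γ ≫
      (λ_ (ctxObj M.ob Γ)).hom ≫ M.tm v = M.tm v := by simp
    rw [← splitHom_allRight M.ob Γ] at h
    exact h
  | unit_eta v w p s =>
    rw [Interpretation.tm, tm_subst, tm_subst]
    exact tm_eq_of_eqn_unit_eta M.ob (M.tm v) (M.tm w) p s
  | hom_beta v w s =>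
    simp only [tm_subst]
    exact tm_eq_of_eqn_hom_beta M.ob (M.tm v) (M.tm w) s
  | hom_eta v => 
    exact tm_eq_of_eqn_hom_eta M.ob (M.tm v) _ (splitHom_right_allLeft M.ob _ _)
  | unit_comm v w s u p t =>
    simp only [Interpretation.tm, tm_subst]
    exact tm_eq_of_eqn_unit_comm M.ob (M.tm v) (M.tm w) s (M.tm u) p t
  | tensor_comm v w s u p t =>
    simp only [Interpretation.tm, tm_subst]
    exact tm_eq_of_eqn_tensor_comm M.ob (M.tm v) (M.tm w) s (M.tm u) p t
  | dis_all v => exact SemiCartesianMonoidalCategory.toUnit_unique _ _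
  | dis_unit v => exact SemiCartesianMonoidalCategory.toUnit_unique _ _

variable {V : Type x} [CommMonoid V] [CompleteLattice V] [EnrichedAffine V C]

open EnrichedAffine

theorem one_le_hdist_self {X Y : C} (f : X ⟶ Y) : (1 : V) ≤ hdist f f :=
  (isVCategory X Y).refl f

variable [IsQuantale V]

theorem hdist_comp_left_le {X Y Z : C} (f : X ⟶ Y) (g g' : Y ⟶ Z) :
    (hdist g g' : V) ≤ hdist (f ≫ g) (f ≫ g') := by
  calc _ = 1 * (hdist g g' : V) := (one_mul _).symm
    _ ≤ hdist f f * hdist g g' := mul_le_mul_left (one_le_hdist_self f) _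
    _ ≤ _ := comp_le _ _ _ _

theorem hdist_comp_right_le {X Y Z : C} (f f' : X ⟶ Y) (g : Y ⟶ Z) :
    (hdist f f' : V) ≤ hdist (f ≫ g) (f' ≫ g) := by
  calc _ = (hdist f f' : V) * 1 := (mul_one _).symm
    _ ≤ hdist f f' * hdist g g := mul_le_mul_right (one_le_hdist_self g) _
    _ ≤ _ := comp_le _ _ _ _

theorem hdist_whiskerRight_le {X Y : C} (f f' : X ⟶ Y) (Z : C) :
    (hdist f f' : V) ≤ hdist (f ▷ Z) (f' ▷ Z) := by
  calc _ = (hdist f f' : V) * 1 := (mul_one _).symm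
    _ ≤ hdist f f' * hdist (𝟙 Z) (𝟙 Z) := mul_le_mul_right (one_le_hdist_self _) _
    _ ≤ _ := by simpa using tensor_le f f' (𝟙 Z) (𝟙 Z)

theorem hdist_whiskerLeft_le {X Y : C} (f f' : X ⟶ Y) (Z : C) :
    (hdist f f' : V) ≤ hdist (Z ◁ f) (Z ◁ f') := by
  calc _ = 1 * (hdist f f' : V) := (one_mul _).symm
    _ ≤ hdist (𝟙 Z) (𝟙 Z) * hdist f f' := mul_le_mul_left (one_le_hdist_self _) _
    _ ≤ _ := by simpa using tensor_le (𝟙 Z) (𝟙 Z) f f'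

theorem hdist_plugHom_le {A : Ty G} {Γ E Δ F : Ctx G} (ob : G → C) (p : Pick A Γ E)
    (t : Shuffle Γ Δ F) (m m' : ctxObj ob Δ ⟶ tyObj ob A) :
    (hdist m m' : V) ≤ hdist (plugHom ob p t m) (plugHom ob p t m') :=
  (hdist_whiskerLeft_le _ _ _).trans
    ((hdist_comp_right_le _ _ _).trans (hdist_comp_left_le _ _ _))

mutual

theorem satisfies_of_thm {B : Set V} {T : AffineTheory V B S} (basis : IsLatticeBasis B)
    (integral : (1 : V) = ⊤) (hM : M.IsModel T) : {Γ : Ctx G} → {A : Ty G} →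
      {v w : Tm S Γ A} → {q : V} → Thm T v q w → q ≤ hdist (M.tm v) (M.tm w)
  | _, _, _, _, _, .ax h => hM _ _ _ h
  | _, _, _, _, _, .eqn h => by
    rw [tm_eq_of_eqn M h, ← integral]; exact one_le_hdist_self _
  | _, _, _, _, _, .eqn_symm h => by
    rw [tm_eq_of_eqn M h, ← integral]; exact one_le_hdist_self _
  | _, _, _, _, _, .refl v => by
    rw [← integral]; exact one_le_hdist_self _
  | _, _, _, _, _, .trans h h' =>
    (mul_le_mul' (satisfies_of_thm basis integral hM h)
      (satisfies_of_thm basis integral hM h')).trans ((isVCategory _ _).trans _ _ _)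
  | _, _, _, _, _, .weak h _ hr => hr.trans (satisfies_of_thm basis integral hM h)
  | _, _, _, _, _, .arch (q := q) _ h =>
    -- The distance bounds all `r ≪ q` in `B`, so it bounds their least upper bound `q`.
    (basis q).2.2.2 fun r hr => satisfies_of_thm basis integral hM (h r hr.1 hr.2)
  | _, _, _, _, _, .join q h => iSup_le fun i => satisfies_of_thm basis integral hM (h i)
  | _, _, _, _, _, .op f h =>
    (args_satisfies_of_thm basis integral hM h).trans (hdist_comp_right_le _ _ _)
  | _, _, _, _, _, .unitE s h h' => by
    simp only [Interpretation.tm]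
    refine le_trans ?_ (hdist_comp_left_le _ _ _)
    refine (mul_le_mul' (satisfies_of_thm basis integral hM h)
      (satisfies_of_thm basis integral hM h')).trans ?_
    exact (mul_le_mul' (hdist_whiskerRight_le _ _ _) (hdist_comp_left_le _ _ _)).trans
      (comp_le _ _ _ _)
  | _, _, _, _, _, .tensor s h h' =>
    (mul_le_mul' (satisfies_of_thm basis integral hM h)
      (satisfies_of_thm basis integral hM h')).trans
        ((tensor_le _ _ _ _).trans (hdist_comp_left_le _ _ _))
  | _, _, _, _, _, .pm s h h' => by
    simp only [Interpretation.tm]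
    refine le_trans ?_ (hdist_comp_left_le _ _ _)
    refine (mul_le_mul' (satisfies_of_thm basis integral hM h)
      (satisfies_of_thm basis integral hM h')).trans ?_
    refine (mul_le_mul' (hdist_whiskerRight_le _ _ _) ?_).trans (comp_le _ _ _ _)
    -- The four structural morphisms before `M.tm w`: the braiding, the associator and the two
    -- morphisms that append a variable.
    iterate 4 refine le_trans ?_ (hdist_comp_left_le _ _ _)
    exact le_rfl
  | _, _, _, _, _, .lam h => by
    simp only [Interpretation.tm]
    refine (satisfies_of_thm basis integral hM h).trans ?_
    refine le_trans ?_ (curry_eq _ _).ge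
    exact (hdist_comp_left_le _ _ _).trans (hdist_comp_left_le _ _ _)
  | _, _, _, _, _, .app s h h' =>
    (mul_le_mul' (satisfies_of_thm basis integral hM h)
      (satisfies_of_thm basis integral hM h')).trans
        ((tensor_le _ _ _ _).trans ((hdist_comp_right_le _ _ _).trans (hdist_comp_left_le _ _ _)))
  | _, _, _, _, _, .dis h =>
    (satisfies_of_thm basis integral hM h).trans (hdist_comp_right_le _ _ _)
  | _, _, _, _, _, .exch p t h => by
    simp only [Tm.move, tm_subst]
    exact (satisfies_of_thm basis integral hM h).trans (hdist_comp_left_le _ _ _)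
  | _, _, _, _, _, .subst p t h h' => by
    simp only [tm_subst]
    -- The label of `v` comes first in the rule, but the morphism of `v` comes last in the
    -- composite.
    rw [mul_comm]
    exact (mul_le_mul' ((satisfies_of_thm basis integral hM h').trans (hdist_plugHom_le _ _ _ _ _))
      (satisfies_of_thm basis integral hM h)).trans (comp_le _ _ _ _)

theorem args_satisfies_of_thm {B : Set V} {T : AffineTheory V B S} (basis : IsLatticeBasis B)
    (integral : (1 : V) = ⊤) (hM : M.IsModel T) : {E : Ctx G} → {As : List (Ty G)} →
      {as bs : Args S E As} → {q : V} → ThmArgs T as q bs → q ≤ hdist (M.args as) (M.args bs)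
  | _, _, _, _, _, .nil => one_le_hdist_self _
  | _, _, _, _, _, .snoc s h h' =>
    (mul_le_mul' (args_satisfies_of_thm basis integral hM h)
      (satisfies_of_thm basis integral hM h')).trans
        ((tensor_le _ _ _ _).trans ((hdist_comp_right_le _ _ _).trans (hdist_comp_left_le _ _ _)))

end

end Soundness

-- Terms modulo provable equality

section Quotient

variable {V : Type x} [CommMonoid V] [CompleteLattice V] {B : Set V} {G : Type u}
  {S : Signature.{u, u'} G} {T : AffineTheory V B S}

/-- Theories labelled in an integral quantale. -/
class AffineTheory.Integral (T : AffineTheory V B S) : Prop where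
  one_eq_top (T) : (1 : V) = ⊤

/-- The supremum defining `synDist` need not itself be known to be a provable label. By the
approximation rule it suffices to prove the labels `r ≪ q` in `B`, and these are reached by finitely
many provable ones. -/
theorem thm_of_le_synDist {Γ : Ctx G} {A : Ty G} {v w : Tm S Γ A} {q : V} (hq : q ∈ B)
    (h : q ≤ T.synDist v w) : Thm T v q w := by
  refine .arch hq fun r hr hrq => ?_
  -- The definition of `r ≪ q` is applied to the set of all provable labels, whose supremum is above
  -- `q`.
  obtain ⟨F, hF, hfin, hle⟩ := hrq _ h
  obtain ⟨n, f, -, rfl⟩ := hfin.fin_param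
  exact .weak (.join f fun i => hF ⟨i, rfl⟩) hr hle

theorem le_synDist {Γ : Ctx G} {A : Ty G} {v w : Tm S Γ A} {q : V} (h : Thm T v q w) :
    q ≤ T.synDist v w :=
  le_sSup h

theorem synDist_le {Γ E : Ctx G} {A C : Ty G} {v w : Tm S Γ A}
    {t s : Tm S E C} (h : ∀ q, Thm T v q w → Thm T t q s) :
    T.synDist v w ≤ T.synDist t s :=
  sSup_le fun q hq => le_synDist (h q hq)

/-- Multiplication distributes over suprema, so a rule that multiplies labels becomes an inequality
of distances. -/
theorem synDist_mul_le [IsQuantale V] {Γ Δ E : Ctx G} {A A' C : Ty G} {v w : Tm S Γ A} {v' w' : Tm S Δ A'}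
    {t s : Tm S E C} (h : ∀ q r, Thm T v q w → Thm T v' r w' → Thm T t (q * r) s) :
    T.synDist v w * T.synDist v' w' ≤ T.synDist t s := by
  rw [AffineTheory.synDist, AffineTheory.synDist, IsQuantale.sSup_mul_distrib]
  refine iSup₂_le fun q hq => ?_
  rw [IsQuantale.mul_sSup_distrib]
  exact iSup₂_le fun r hr => le_synDist (h q r hq hr)

theorem synDist_trans [IsQuantale V] {Γ : Ctx G} {A : Ty G} (v w u : Tm S Γ A) :
    T.synDist v w * T.synDist w u ≤ T.synDist v u :=
  synDist_mul_le fun _ _ => .trans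

variable [T.Integral]

theorem one_le_synDist_self {Γ : Ctx G} {A : Ty G} (v : Tm S Γ A) : 1 ≤ T.synDist v v :=
  AffineTheory.Integral.one_eq_top T ▸ le_synDist (.refl v)

theorem one_le_mul_self [IsQuantale V] {q r : V} (hq : 1 ≤ q) (hr : 1 ≤ r) : 1 ≤ q * r :=
  (one_mul (1 : V)).symm.le.trans (mul_le_mul' hq hr)

variable [IsQuantale V]

/-- Provable equality of terms. -/
def AffineTheory.setoid (T : AffineTheory V B S) [T.Integral] (Γ : Ctx G) (A : Ty G) :
    Setoid (Tm S Γ A) where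
  r v w := 1 ≤ T.synDist v w ∧ 1 ≤ T.synDist w v
  iseqv :=
    { refl := fun v => ⟨one_le_synDist_self v, one_le_synDist_self v⟩
      symm := fun h => ⟨h.2, h.1⟩
      trans := fun h h' => ⟨(one_le_mul_self h.1 h'.1).trans (synDist_trans _ _ _),
        (one_le_mul_self h'.2 h.2).trans (synDist_trans _ _ _)⟩ }

/-- Terms modulo provable equality. -/
def Q (T : AffineTheory V B S) [T.Integral] (Γ : Ctx G) (A : Ty G) : Type (max u u') :=
  Quotient (T.setoid Γ A)

namespace Q

variable {Γ Δ Θ E F X : Ctx G} {A A' C D : Ty G}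

/-- The class of a term. -/
def mk (T : AffineTheory V B S) [T.Integral] (v : Tm S Γ A) : Q T Γ A := Quotient.mk _ v

theorem mk_eq_of_eqn {v w : Tm S Γ A} (h : Eqn v w) : mk T v = mk T w :=
  Quotient.sound ⟨AffineTheory.Integral.one_eq_top T ▸ le_synDist (.eqn h),
    AffineTheory.Integral.one_eq_top T ▸ le_synDist (.eqn_symm h)⟩

theorem ind {P : Q T Γ A → Prop} (h : ∀ v, P (mk T v)) (x : Q T Γ A) : P x :=
  Quotient.ind h x

variable (T) in
/-- Operations that respect provable equality. -/
def map (f : Tm S Γ A → Tm S E C) (h : ∀ v w, T.synDist v w ≤ T.synDist (f v) (f w)) :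
    Q T Γ A → Q T E C :=
  Quotient.map f fun _ _ hv => ⟨hv.1.trans (h _ _), hv.2.trans (h _ _)⟩

variable (T) in
/-- Binary operations that respect provable equality. -/
def map₂ (f : Tm S Γ A → Tm S Δ A' → Tm S E C)
    (h : ∀ v w v' w', T.synDist v w * T.synDist v' w' ≤ T.synDist (f v v') (f w w')) :
    Q T Γ A → Q T Δ A' → Q T E C :=
  Quotient.map₂ f fun _ _ hv _ _ hw => ⟨(one_le_mul_self hv.1 hw.1).trans (h _ _ _ _),
    (one_le_mul_self hv.2 hw.2).trans (h _ _ _ _)⟩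

/-- The distance of classes of terms. -/
noncomputable def dist : Q T Γ A → Q T Γ A → V :=
  Quotient.lift₂ T.synDist fun v w v' w' hv hw => by
    -- Replacing both terms by equal ones costs two factors above `1`, by the triangle inequality.
    have key {a b c d : V} (hb : 1 ≤ b) (hd : 1 ≤ d) (h : b * a * d ≤ c) : a ≤ c := by
      refine le_trans ?_ h
      calc a = 1 * a * 1 := by simp
        _ ≤ _ := mul_le_mul' (mul_le_mul' hb le_rfl) hd
    exact le_antisymm
      (key hv.2 hw.1 ((mul_le_mul' (synDist_trans _ _ _) le_rfl).trans (synDist_trans _ _ _)))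
      (key hv.1 hw.2 ((mul_le_mul' (synDist_trans _ _ _) le_rfl).trans (synDist_trans _ _ _)))

theorem one_le_dist_self (v : Q T Γ A) : 1 ≤ dist v v :=
  ind (P := fun v => 1 ≤ dist v v) (fun v => one_le_synDist_self v) v

theorem dist_trans (v w u : Q T Γ A) : dist v w * dist w u ≤ dist v u := by
  induction v using ind; induction w using ind; induction u using ind
  exact synDist_trans _ _ _

theorem eq_of_dist {v w : Q T Γ A} (h : 1 ≤ dist v w) (h' : 1 ≤ dist w v) : v = w := by
  induction v using ind; induction w using ind
  exact Quotient.sound ⟨h, h'⟩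

/-- Separatedness turns every extensionality inequality below into an extensionality principle for
equality. -/
theorem eq_of_dist_le {v w : Q T Γ A} {v' w' : Q T Δ C} (h : dist v w ≤ dist v' w')
    (h' : dist w v ≤ dist w' v') (e : v = w) : v' = w' :=
  eq_of_dist ((one_le_dist_self _).trans (e ▸ h)) ((one_le_dist_self _).trans (e ▸ h'))

variable (T) in
/-- The class of a variable. -/
def var {A : Ty G} : Q T [A] A := mk T .var

variable (T) in
/-- The class of `*`. -/
def star : Q T [] .unit := mk T .star

/-- Elimination of the unit. -/
def unitE (v : Q T Γ .unit) (w : Q T Δ A) (s : Shuffle Γ Δ E) : Q T E A :=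
  map₂ T (fun v w => .unitE v w s) (fun _ _ _ _ => synDist_mul_le fun _ _ => .unitE s) v w

/-- Tensor of terms. -/
def tensor (v : Q T Γ A) (w : Q T Δ A') (s : Shuffle Γ Δ E) : Q T E (.tensor A A') :=
  map₂ T (fun v w => .tensor v w s) (fun _ _ _ _ => synDist_mul_le fun _ _ => .tensor s) v w

/-- Elimination of the tensor. -/
def pm (v : Q T Γ (.tensor A A')) (w : Q T (A' :: A :: Δ) C) (s : Shuffle Γ Δ E) : Q T E C :=
  map₂ T (fun v w => .pm v w s) (fun _ _ _ _ => synDist_mul_le fun _ _ => .pm s) v w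

/-- Application. -/
def app (v : Q T Γ (.hom A C)) (w : Q T Δ A) (s : Shuffle Γ Δ E) : Q T E C :=
  map₂ T (fun v w => .app v w s) (fun _ _ _ _ => synDist_mul_le fun _ _ => .app s) v w

/-- Abstraction. -/
def lam (v : Q T (A :: Γ) C) : Q T Γ (.hom A C) :=
  map T .lam (fun _ _ => synDist_le fun _ => .lam) v

/-- Discarding. -/
def dis (v : Q T Γ A) : Q T Γ .unit :=
  map T .dis (fun _ _ => synDist_le fun _ => .dis) v

/-- Substitution. -/
def subst (v : Q T E C) (p : Pick A Γ E) (w : Q T Δ A) (t : Shuffle Γ Δ F) : Q T F C :=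
  map₂ T (fun v w => v.subst p w t) (fun _ _ _ _ => synDist_mul_le fun _ _ => .subst p t) v w

theorem mul_dist_tensor_le (v v' : Q T Γ A) (w w' : Q T Δ A') (s : Shuffle Γ Δ E) :
    dist v v' * dist w w' ≤ dist (tensor v w s) (tensor v' w' s) := by
  induction v using ind; induction w using ind; induction v' using ind; induction w' using ind
  exact synDist_mul_le fun _ _ => .tensor s

theorem mul_dist_pm_le (v v' : Q T Γ (.tensor A A')) (w w' : Q T (A' :: A :: Δ) C)
    (s : Shuffle Γ Δ E) : dist v v' * dist w w' ≤ dist (pm v w s) (pm v' w' s) := by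
  induction v using ind; induction w using ind; induction v' using ind; induction w' using ind
  exact synDist_mul_le fun _ _ => .pm s

theorem mul_dist_unitE_le (v v' : Q T Γ .unit) (w w' : Q T Δ C)
    (s : Shuffle Γ Δ E) : dist v v' * dist w w' ≤ dist (unitE v w s) (unitE v' w' s) := by
  induction v using ind; induction w using ind; induction v' using ind; induction w' using ind
  exact synDist_mul_le fun _ _ => .unitE s

theorem mul_dist_app_le (v v' : Q T Γ (.hom A C)) (w w' : Q T Δ A) (s : Shuffle Γ Δ E) :
    dist v v' * dist w w' ≤ dist (app v w s) (app v' w' s) := by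
  induction v using ind; induction w using ind; induction v' using ind; induction w' using ind
  exact synDist_mul_le fun _ _ => .app s

theorem dist_lam_le (v v' : Q T (A :: Γ) C) : dist v v' ≤ dist (lam v) (lam v') := by
  induction v using ind; induction v' using ind
  exact synDist_le fun _ => .lam

theorem dist_le_of_mul_left {a b c : V} (ha : 1 ≤ a) (h : a * b ≤ c) : b ≤ c :=
  le_trans (by simpa using mul_le_mul' ha (le_refl b)) h

theorem dist_le_of_mul_right {a b c : V} (ha : 1 ≤ b) (h : a * b ≤ c) : a ≤ c :=
  dist_le_of_mul_left ha (mul_comm a b ▸ h)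

theorem dist_app_le (v v' : Q T Γ (.hom A C)) (w : Q T Δ A) (s : Shuffle Γ Δ E) :
    dist v v' ≤ dist (app v w s) (app v' w s) :=
  dist_le_of_mul_right (one_le_dist_self w) (mul_dist_app_le _ _ _ _ _)

theorem dist_pm_le (v : Q T Γ (.tensor A A')) (w w' : Q T (A' :: A :: Δ) C)
    (s : Shuffle Γ Δ E) : dist w w' ≤ dist (pm v w s) (pm v w' s) :=
  dist_le_of_mul_left (one_le_dist_self v) (mul_dist_pm_le _ _ _ _ _)

theorem dist_unitE_le (v : Q T Γ .unit) (w w' : Q T Δ C)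
    (s : Shuffle Γ Δ E) : dist w w' ≤ dist (unitE v w s) (unitE v w' s) :=
  dist_le_of_mul_left (one_le_dist_self v) (mul_dist_unitE_le _ _ _ _ _)

theorem app_lam (v : Q T (A :: Γ) C) (w : Q T Δ A) (s : Shuffle Γ Δ E) :
    app (lam v) w s = v.subst .here w s := by
  induction v using ind; induction w using ind
  exact mk_eq_of_eqn (.hom_beta _ _ _)

theorem lam_app (v : Q T Γ (.hom A C)) : lam (app v (var T) (.right (.allLeft Γ))) = v := by
  induction v using ind
  exact mk_eq_of_eqn (.hom_eta _)

theorem pm_tensor (v : Q T Γ A) (w : Q T Δ A') (u : Q T (A' :: A :: Θ) C) (s : Shuffle Γ Δ F)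
    (t : Shuffle F Θ E) : pm (tensor v w s) u t =
      (u.subst .here w (.left (s.assoc t).2.1.swap)).subst .here v (s.assoc t).2.2.swap := by
  induction v using ind; induction w using ind; induction u using ind
  exact mk_eq_of_eqn (.tensor_beta _ _ _ _ _)

theorem pm_subst_tensor (v : Q T Γ (.tensor A A')) (u : Q T X C) (p : Pick (.tensor A A') Δ X)
    (s : Shuffle Γ Δ E) :
    pm v (u.subst p (tensor (var T) (var T) (.right (.left .nil))) (.right (.right (.allLeft Δ)))) s =
      u.subst p v s.swap := by
  induction v using ind; induction u using ind
  exact mk_eq_of_eqn (.tensor_eta _ _ _ _)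

theorem unitE_star (v : Q T Γ A) : unitE (star T) v (.allRight Γ) = v := by
  induction v using ind
  exact mk_eq_of_eqn (.unit_beta _)

theorem unitE_subst_star (v : Q T Γ .unit) (w : Q T X C) (p : Pick .unit Δ X) (s : Shuffle Γ Δ E) :
    unitE v (w.subst p (star T) (.allLeft Δ)) s = w.subst p v s.swap := by
  induction v using ind; induction w using ind
  exact mk_eq_of_eqn (.unit_eta _ _ _ _)

theorem subst_unitE (v : Q T Γ .unit) (w : Q T Δ A) (s : Shuffle Γ Δ F) (u : Q T X C)
    (p : Pick A Θ X) (t : Shuffle Θ F E) : u.subst p (unitE v w s) t =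
      unitE v (u.subst p w (s.assoc t.swap).2.1.swap) (s.assoc t.swap).2.2 := by
  induction v using ind; induction w using ind; induction u using ind
  exact mk_eq_of_eqn (.unit_comm _ _ _ _ _ _)

theorem dis_eq_dis (v : Q T Γ A) (w : Q T Γ A') : dis v = dis w := by
  induction v using ind; induction w using ind
  exact (mk_eq_of_eqn (.dis_all _)).trans (mk_eq_of_eqn (.dis_all _)).symm

theorem unitE_dis_star (v : Q T Γ .unit) :
    unitE v (star T) (.allLeft Γ) = unitE (dis v) (star T) (.allLeft Γ) := by
  induction v using ind
  exact mk_eq_of_eqn (.dis_unit _)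

/-! ### Computing substitutions -/

theorem var_subst (w : Q T Δ A) : (var T).subst .here w (.allRight Δ) = w := by
  induction w using ind
  rfl

theorem lam_subst (v : Q T (A' :: E) C) (p : Pick A Γ E) (w : Q T Δ A) (t : Shuffle Γ Δ F) :
    (lam v).subst p w t = lam (v.subst (.there p) w (.left t)) := by
  induction v using ind; induction w using ind
  rfl

/-- Application of a function without free variables. -/
def ap (f : Q T [] (.hom A C)) (v : Q T Γ A) : Q T Γ C := app f v (.allRight Γ)

theorem ap_lam (v : Q T [A] C) (w : Q T Δ A) : ap (lam v) w = v.subst .here w (.allRight Δ) :=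
  app_lam _ _ _

section

variable {Γ' Γ₁ Γ₂ Y E' : Ctx G} {s : Shuffle Γ Δ E} {p : Pick D E' E} {t : Shuffle E' Θ F}
  {p₁ : Pick D Γ₁ Γ} {s₁ : Shuffle Γ₁ Δ E'} {r₁ : Shuffle Γ₁ Θ Y} {r₂ : Shuffle Δ Y F}
  {p₂ : Pick D Γ₂ Δ} {s₂ : Shuffle Γ Γ₂ E'} {q₁ : Shuffle Γ₂ Θ Y} {q₂ : Shuffle Γ Y F}

/-- In this family the outcomes of `locate` and `assoc` enter as hypotheses, so that the
intermediate contexts, which occur in the types of the subterms, are free variables and not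
projections of a dependent pair. -/
theorem tensor_subst_left (v : Q T Γ A) (v' : Q T Δ A') (w : Q T Θ D)
    (h : s.locate p = .inl ⟨Γ₁, p₁, s₁⟩) (h' : s₁.swap.assoc t = ⟨Y, r₁, r₂⟩) :
    (tensor v v' s).subst p w t = tensor (v.subst p₁ w r₁) v' r₂.swap := by
  induction v using ind; induction v' using ind; induction w using ind
  refine congrArg (mk T) ?_
  simp only [Tm.subst, h]
  rw [h']

theorem tensor_subst_right (v : Q T Γ A) (v' : Q T Δ A') (w : Q T Θ D)
    (h : s.locate p = .inr ⟨Γ₂, p₂, s₂⟩) (h' : s₂.assoc t = ⟨Y, q₁, q₂⟩) :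
    (tensor v v' s).subst p w t = tensor v (v'.subst p₂ w q₁) q₂ := by
  induction v using ind; induction v' using ind; induction w using ind
  refine congrArg (mk T) ?_
  simp only [Tm.subst, h]
  rw [h']

theorem unitE_subst_left (v : Q T Γ .unit) (v' : Q T Δ A') (w : Q T Θ D)
    (h : s.locate p = .inl ⟨Γ₁, p₁, s₁⟩) (h' : s₁.swap.assoc t = ⟨Y, r₁, r₂⟩) :
    (unitE v v' s).subst p w t = unitE (v.subst p₁ w r₁) v' r₂.swap := by
  induction v using ind; induction v' using ind; induction w using ind
  refine congrArg (mk T) ?_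
  simp only [Tm.subst, h]
  rw [h']

theorem unitE_subst_right (v : Q T Γ .unit) (v' : Q T Δ A') (w : Q T Θ D)
    (h : s.locate p = .inr ⟨Γ₂, p₂, s₂⟩) (h' : s₂.assoc t = ⟨Y, q₁, q₂⟩) :
    (unitE v v' s).subst p w t = unitE v (v'.subst p₂ w q₁) q₂ := by
  induction v using ind; induction v' using ind; induction w using ind
  refine congrArg (mk T) ?_
  simp only [Tm.subst, h]
  rw [h']

theorem app_subst_left (v : Q T Γ (.hom A C)) (v' : Q T Δ A) (w : Q T Θ D)
    (h : s.locate p = .inl ⟨Γ₁, p₁, s₁⟩) (h' : s₁.swap.assoc t = ⟨Y, r₁, r₂⟩) :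
    (app v v' s).subst p w t = app (v.subst p₁ w r₁) v' r₂.swap := by
  induction v using ind; induction v' using ind; induction w using ind
  refine congrArg (mk T) ?_
  simp only [Tm.subst, h]
  rw [h']

theorem app_subst_right (v : Q T Γ (.hom A C)) (v' : Q T Δ A) (w : Q T Θ D)
    (h : s.locate p = .inr ⟨Γ₂, p₂, s₂⟩) (h' : s₂.assoc t = ⟨Y, q₁, q₂⟩) :
    (app v v' s).subst p w t = app v (v'.subst p₂ w q₁) q₂ := by
  induction v using ind; induction v' using ind; induction w using ind
  refine congrArg (mk T) ?_
  simp only [Tm.subst, h]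
  rw [h']

theorem pm_subst_left (v : Q T Γ (.tensor A A')) (v' : Q T (A' :: A :: Δ) C) (w : Q T Θ D)
    (h : s.locate p = .inl ⟨Γ₁, p₁, s₁⟩) (h' : s₁.swap.assoc t = ⟨Y, r₁, r₂⟩) :
    (pm v v' s).subst p w t = pm (v.subst p₁ w r₁) v' r₂.swap := by
  induction v using ind; induction v' using ind; induction w using ind
  refine congrArg (mk T) ?_
  simp only [Tm.subst, h]
  rw [h']

theorem pm_subst_right (v : Q T Γ (.tensor A A')) (v' : Q T (A' :: A :: Δ) C) (w : Q T Θ D)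
    (h : s.locate p = .inr ⟨Γ₂, p₂, s₂⟩) (h' : s₂.assoc t = ⟨Y, q₁, q₂⟩) :
    (pm v v' s).subst p w t = pm v (v'.subst (.there (.there p₂)) w (.left (.left q₁))) q₂ := by
  induction v using ind; induction v' using ind; induction w using ind
  refine congrArg (mk T) ?_
  simp only [Tm.subst, h]
  rw [h']

end

theorem ap_subst (f : Q T [] (.hom A' C)) (v : Q T E A') (p : Pick A Γ E) (w : Q T Δ A)
    (t : Shuffle Γ Δ F) : (ap f v).subst p w t = ap f (v.subst p w t) :=
  app_subst_right f v w (Shuffle.locate_allRight p) (Shuffle.assoc_allRight t)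

theorem lam_app_subst (u : Q T Γ (.hom A C)) (w : Q T Δ A) (s : Shuffle Γ Δ E) :
    (app u (var T) (.right (.allLeft Γ))).subst .here w s = app u w s := by
  rw [app_subst_right (s₂ := .allLeft Γ) u (var T) w rfl (Shuffle.assoc_allLeft _), var_subst]

/-! ### Extensionality -/

/-- By η, `u` is the abstraction of `u x`, and abstraction does not decrease `dist`. -/
theorem dist_le_of_app_var (u u' : Q T Γ (.hom A C)) :
    dist (app u (var T) (.right (.allLeft Γ))) (app u' (var T) (.right (.allLeft Γ))) ≤
      dist u u' := by
  simpa only [lam_app] using dist_lam_le (app u (var T) (.right (.allLeft Γ)))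
    (app u' (var T) (.right (.allLeft Γ)))

/-- The η-rule for `pm`, applied to the term `u z` with `z` replaced once by `x ⊗ y` and once by a
variable. It reduces a generic argument of tensor type to `x ⊗ y`. -/
theorem app_var_eq_pm (u : Q T Γ (.hom (.tensor A A') C)) :
    app u (var T) (.right (.allLeft Γ)) = pm (var T) (app u
      (tensor (var T) (var T) (.right (.left .nil))) (.right (.right (.allLeft Γ))))
        (.left (.allRight Γ)) := by
  have h := pm_subst_tensor (var T) (app u (var T) (.right (.allLeft Γ))) .here
    (.left (.allRight Γ))
  rw [lam_app_subst, lam_app_subst] at h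
  rw [h, Shuffle.swap, Shuffle.swap_allRight]

theorem dist_le_of_app_tensor (u u' : Q T Γ (.hom (.tensor A A') C)) :
    dist (app u (tensor (var T) (var T) (.right (.left .nil))) (.right (.right (.allLeft Γ))))
      (app u' (tensor (var T) (var T) (.right (.left .nil))) (.right (.right (.allLeft Γ)))) ≤
        dist u u' := by
  refine le_trans ?_ (dist_le_of_app_var _ _)
  rw [app_var_eq_pm u, app_var_eq_pm u']
  exact dist_pm_le _ _ _ _

theorem app_var_eq_unitE (u : Q T Γ (.hom .unit C)) :
    app u (var T) (.right (.allLeft Γ)) = unitE (var T) (app u (star T) (.allLeft Γ))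
      (.left (.allRight Γ)) := by
  have h := unitE_subst_star (var T) (app u (var T) (.right (.allLeft Γ))) .here
    (.left (.allRight Γ))
  rw [lam_app_subst, lam_app_subst] at h
  rw [h, Shuffle.swap, Shuffle.swap_allRight]

theorem dist_le_of_app_star (u u' : Q T Γ (.hom .unit C)) :
    dist (app u (star T) (.allLeft Γ)) (app u' (star T) (.allLeft Γ)) ≤ dist u u' := by
  refine le_trans ?_ (dist_le_of_app_var _ _)
  rw [app_var_eq_unitE u, app_var_eq_unitE u']
  exact dist_unitE_le _ _ _ _

theorem hom_ext {u u' : Q T Γ (.hom A C)}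
    (h : app u (var T) (.right (.allLeft Γ)) = app u' (var T) (.right (.allLeft Γ))) : u = u' :=
  eq_of_dist_le (dist_le_of_app_var _ _) (dist_le_of_app_var _ _) h

theorem hom_ext_tensor {u u' : Q T Γ (.hom (.tensor A A') C)}
    (h : app u (tensor (var T) (var T) (.right (.left .nil))) (.right (.right (.allLeft Γ))) =
      app u' (tensor (var T) (var T) (.right (.left .nil))) (.right (.right (.allLeft Γ)))) :
    u = u' :=
  eq_of_dist_le (dist_le_of_app_tensor _ _) (dist_le_of_app_tensor _ _) h

theorem hom_ext_unit {u u' : Q T Γ (.hom .unit C)}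
    (h : app u (star T) (.allLeft Γ) = app u' (star T) (.allLeft Γ)) : u = u' :=
  eq_of_dist_le (dist_le_of_app_star _ _) (dist_le_of_app_star _ _) h

end Q

end Quotient

-- The calculus of closed functions

section ClosedFunctions

variable {V : Type x} [CommMonoid V] [CompleteLattice V] [IsQuantale V] {B : Set V} {G : Type u}
  {S : Signature.{u, u'} G} {T : AffineTheory V B S} [T.Integral]

namespace Q

variable {Γ Δ Θ E F X : Ctx G} {A A' A₁ A₂ A₃ C D : Ty G}

open Shuffle

theorem ap_var_subst (f : Q T [] (.hom A C)) (v : Q T Γ A) :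
    (ap f (var T)).subst .here v (.allRight Γ) = ap f v := by
  rw [ap_subst, var_subst]

/-- The commuting conversion for the term `f z`, whose only free variable is `z`. `ap_pm` is the
analogue for pattern matching. -/
theorem ap_unitE (f : Q T [] (.hom A C)) (v : Q T Γ .unit) (w : Q T Δ A) (s : Shuffle Γ Δ E) :
    ap f (unitE v w s) = unitE v (ap f w) s := by
  have h := subst_unitE v w s (ap f (var T)) .here (.allRight E)
  rw [ap_var_subst] at h
  rw [h, swap_allRight, assoc_allLeft_right]
  simp only [swap_allLeft, ap_var_subst]

theorem subst_pm (v : Q T Γ (.tensor A A')) (w : Q T (A' :: A :: Δ) C) (s : Shuffle Γ Δ F)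
    (u : Q T X D) (p : Pick C Θ X) (t : Shuffle Θ F E) : u.subst p (pm v w s) t =
      pm v (u.subst p w (.right (.right (s.assoc t.swap).2.1.swap))) (s.assoc t.swap).2.2 := by
  induction v using ind; induction w using ind; induction u using ind
  exact mk_eq_of_eqn (.tensor_comm _ _ _ _ _ _)

theorem ap_pm (f : Q T [] (.hom C D)) (v : Q T Γ (.tensor A A')) (w : Q T (A' :: A :: Δ) C)
    (s : Shuffle Γ Δ E) : ap f (pm v w s) = pm v (ap f w) s := by
  have h := subst_pm v w s (ap f (var T)) .here (.allRight E)
  rw [ap_var_subst] at h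
  rw [h, swap_allRight, assoc_allLeft_right]
  simp only [swap_allLeft]
  exact congrArg (pm v · s) (ap_var_subst f w)

/-- The function defined by pattern matching on a tensor. -/
def bil (c : Q T [A', A] C) : Q T [] (.hom (.tensor A A') C) := lam (pm (var T) c (.left .nil))

theorem ap_bil_eq_pm (c : Q T [A', A] C) (v : Q T Γ (.tensor A A')) :
    ap (bil c) v = pm v c (.allLeft Γ) := by
  rw [bil, ap_lam, pm_subst_left (s₁ := .nil) (var T) c v rfl (assoc_allRight (Γ := []) _),
    var_subst, swap_allRight]

theorem ap_bil (c : Q T [A', A] C) (v : Q T Γ A) (w : Q T Δ A') (s : Shuffle Γ Δ E) :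
    ap (bil c) (tensor v w s) = (c.subst .here w (.left (.allRight Δ))).subst .here v s.swap := by
  rw [ap_bil_eq_pm, pm_tensor, assoc_allLeft_right]
  simp only [swap_allLeft]

variable (T) in
/-- The identity function. -/
def idFun (A : Ty G) : Q T [] (.hom A A) := lam (var T)

@[simp] theorem ap_idFun (v : Q T Γ A) : ap (idFun T A) v = v := by
  rw [idFun, ap_lam, var_subst]

/-- Composition of functions. -/
def compFun (f : Q T [] (.hom A C)) (g : Q T [] (.hom C D)) : Q T [] (.hom A D) :=
  lam (ap g (ap f (var T)))

@[simp] theorem ap_compFun (f : Q T [] (.hom A C)) (g : Q T [] (.hom C D)) (v : Q T Γ A) :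
    ap (compFun f g) v = ap g (ap f v) := by
  rw [compFun, ap_lam, ap_subst, ap_subst, var_subst]

/-- Tensor of functions. -/
def tensorFun (f : Q T [] (.hom A C)) (g : Q T [] (.hom A' D)) :
    Q T [] (.hom (.tensor A A') (.tensor C D)) :=
  bil (tensor (ap f (var T)) (ap g (var T)) (.right (.left .nil)))

@[simp] theorem ap_tensorFun (f : Q T [] (.hom A C)) (g : Q T [] (.hom A' D)) (v : Q T Γ A)
    (w : Q T Δ A') (s : Shuffle Γ Δ E) :
    ap (tensorFun f g) (tensor v w s) = tensor (ap f v) (ap g w) s := by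
  rw [tensorFun, ap_bil, tensor_subst_right (s₂ := .left .nil) _ _ w rfl (assoc_allLeft (Γ := [A]) _),
    tensor_subst_left (s₁ := .allRight Δ) _ _ v rfl ((swap_allRight Δ).symm ▸ assoc_allLeft _),
    ap_var_subst, ap_var_subst, swap_swap]

variable (T) in
/-- The symmetry. -/
def swapFun (A A' : Ty G) : Q T [] (.hom (.tensor A A') (.tensor A' A)) :=
  bil (tensor (var T) (var T) (.left (.right .nil)))

@[simp] theorem ap_swapFun (v : Q T Γ A) (w : Q T Δ A') (s : Shuffle Γ Δ E) :
    ap (swapFun T A A') (tensor v w s) = tensor w v s.swap := by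
  rw [swapFun, ap_bil, tensor_subst_left (s₁ := .right (A := A) .nil) _ _ w rfl (assoc_allLeft (Γ := [A]) _),
    Shuffle.swap, tensor_subst_right (s₂ := .allLeft Δ) _ _ v (by rw [swap_allRight]; rfl) (assoc_allLeft _),
    var_subst, var_subst]

variable (T) in
/-- The left unitor. -/
def leftUnitFun (A : Ty G) : Q T [] (.hom (.tensor .unit A) A) :=
  bil (unitE (var T) (var T) (.right (.left .nil)))

@[simp] theorem ap_leftUnitFun (v : Q T Γ .unit) (w : Q T Δ A) (s : Shuffle Γ Δ E) :
    ap (leftUnitFun T A) (tensor v w s) = unitE v w s := by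
  rw [leftUnitFun, ap_bil,
    unitE_subst_right (s₂ := .left .nil) _ _ w rfl (assoc_allLeft (Γ := [.unit]) _),
    unitE_subst_left (s₁ := .allRight Δ) _ _ v rfl ((swap_allRight Δ).symm ▸ assoc_allLeft _),
    var_subst, var_subst, swap_swap]

variable (T) in
/-- The inverse of the left unitor. -/
def leftUnitInvFun (A : Ty G) : Q T [] (.hom A (.tensor .unit A)) :=
  lam (tensor (star T) (var T) (.right .nil))

@[simp] theorem ap_leftUnitInvFun (v : Q T Γ A) :
    ap (leftUnitInvFun T A) v = tensor (star T) v (.allRight Γ) := by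
  rw [leftUnitInvFun, ap_lam,
    tensor_subst_right (s₂ := .nil) _ _ v rfl (assoc_allRight (Γ := []) _), var_subst]

variable (T) in
/-- The right unitor. -/
def rightUnitFun (A : Ty G) : Q T [] (.hom (.tensor A .unit) A) :=
  bil (unitE (var T) (var T) (.left (.right .nil)))

@[simp] theorem ap_rightUnitFun (v : Q T Γ A) (w : Q T Δ .unit) (s : Shuffle Γ Δ E) :
    ap (rightUnitFun T A) (tensor v w s) = unitE w v s.swap := by
  rw [rightUnitFun, ap_bil,
    unitE_subst_left (s₁ := .right (A := A) .nil) _ _ w rfl (assoc_allLeft (Γ := [A]) _),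
    Shuffle.swap, unitE_subst_right (s₂ := .allLeft Δ) _ _ v (by rw [swap_allRight]; rfl) (assoc_allLeft _),
    var_subst, var_subst]

variable (T) in
/-- The inverse of the right unitor. -/
def rightUnitInvFun (A : Ty G) : Q T [] (.hom A (.tensor A .unit)) :=
  lam (tensor (var T) (star T) (.left .nil))

@[simp] theorem ap_rightUnitInvFun (v : Q T Γ A) :
    ap (rightUnitInvFun T A) v = tensor v (star T) (.allLeft Γ) := by
  rw [rightUnitInvFun, ap_lam,
    tensor_subst_left (s₁ := .nil) _ _ v rfl (assoc_allRight (Γ := []) _), var_subst,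
    swap_allRight]

variable (T) in
/-- The associator. -/
def assocFun (A₁ A₂ A₃ : Ty G) :
    Q T [] (.hom (.tensor (.tensor A₁ A₂) A₃) (.tensor A₁ (.tensor A₂ A₃))) :=
  bil (pm (var T) (tensor (var T) (tensor (var T) (var T) (.left (.right .nil)))
    (.right (.left (.right .nil)))) (.right (.left .nil)))

theorem ap_assocFun_eq_pm (v : Q T Γ (.tensor A₁ A₂)) (w : Q T Δ A₃) (s : Shuffle Γ Δ E) :
    ap (assocFun T A₁ A₂ A₃) (tensor v w s) = pm v (tensor (var T)
      (tensor (var T) w (.left (.allRight Δ))) (.right (.left (.allRight Δ)))) s := by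
  have h : assoc (.right (A := A₂) (.left (A := A₁) .nil)) (.left (.left (.allRight Δ))) =
      ⟨_, .left (.allRight Δ), .right (.left (.allRight Δ))⟩ := by
    simp only [assoc]
    rw [show assoc (.left (A := A₁) .nil) (.left (allRight Δ)) = ⟨Δ, allRight Δ, _⟩ from
      assoc_allLeft (Γ := [A₁]) _]
  rw [assocFun, ap_bil,
    pm_subst_right (s₂ := .left .nil) _ _ w rfl (assoc_allLeft (Γ := [.tensor A₁ A₂]) _),
    pm_subst_left (s₁ := .allRight Δ) _ _ v rfl ((swap_allRight Δ).symm ▸ assoc_allLeft _),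
    swap_swap, var_subst, tensor_subst_right (s₂ := .right (.left .nil)) _ _ w rfl h,
    tensor_subst_right (s₂ := .left .nil) _ _ w rfl (assoc_allLeft (Γ := [A₂]) _), var_subst]

@[simp] theorem ap_assocFun (v₁ : Q T Γ A₁) (v₂ : Q T Δ A₂) (s : Shuffle Γ Δ F) (v₃ : Q T Θ A₃)
    (t : Shuffle F Θ E) : ap (assocFun T A₁ A₂ A₃) (tensor (tensor v₁ v₂ s) v₃ t) =
      tensor v₁ (tensor v₂ v₃ (s.assoc t).2.1) (s.assoc t).2.2 := by
  have h {X : Ctx G} (u : Shuffle Θ Δ X) : assoc (.left (A := A₁) (.allRight Θ)) (.left u) =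
      ⟨_, u, .left (.allRight _)⟩ := by
    simp only [assoc]
    rw [assoc_allRight]
  rw [ap_assocFun_eq_pm, pm_tensor,
    tensor_subst_right (s₂ := .left (.allRight Θ)) _ _ v₂ rfl (h _),
    tensor_subst_left (s₁ := .allRight Θ) _ _ v₂ rfl ((swap_allRight Θ).symm ▸ assoc_allLeft _),
    tensor_subst_left (s₁ := .allRight _) _ _ v₁ rfl ((swap_allRight _).symm ▸ assoc_allLeft _),
    var_subst, var_subst, swap_swap, swap_swap]

variable (T) in
/-- The inverse of the associator. -/
def assocInvFun (A₁ A₂ A₃ : Ty G) :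
    Q T [] (.hom (.tensor A₁ (.tensor A₂ A₃)) (.tensor (.tensor A₁ A₂) A₃)) :=
  bil (pm (var T) (tensor (tensor (var T) (var T) (.right (.left .nil))) (var T)
    (.right (.left (.left .nil)))) (.left (.right .nil)))

/-- Here `w` need not be a tensor of terms, so one pattern matching remains. The interpretation of
`pm` uses the inverse associator in exactly this form. -/
theorem ap_assocInvFun_eq_pm (v : Q T Γ A₁) (w : Q T Δ (.tensor A₂ A₃)) (s : Shuffle Γ Δ E) :
    ap (assocInvFun T A₁ A₂ A₃) (tensor v w s) = pm w (tensor (tensor v (var T)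
      (.right (.allLeft Γ))) (var T) (.right (.allLeft (A₂ :: Γ)))) s.swap := by
  have h : assoc (.left (A := A₃) (.right (A := A₂) .nil)) (.left (.left (.allRight Γ))) =
      ⟨_, .left (.allRight Γ), .left (.right (.allRight Γ))⟩ := by
    simp only [assoc]
    rw [show assoc (.right (A := A₂) .nil) (.left (allRight Γ)) = ⟨_, _, allRight (A₂ :: Γ)⟩ from
      assoc_allRight (Γ := [A₂]) _]
    rfl
  rw [assocInvFun, ap_bil,
    pm_subst_left (s₁ := .right (A := A₁) .nil) _ _ w rfl (assoc_allLeft (Γ := [A₁]) _),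
    Shuffle.swap,
    pm_subst_right (s₂ := .allLeft Δ) _ _ v (by rw [swap_allRight]; rfl) (assoc_allLeft _),
    var_subst, tensor_subst_left (s₁ := .right (A := A₃) (.left (A := A₂) .nil)) _ _ v rfl h,
    tensor_subst_left (s₁ := .right (A := A₂) .nil) _ _ v rfl (assoc_allLeft (Γ := [A₂]) _),
    var_subst]
  simp only [Shuffle.swap, swap_allRight, allLeft]

@[simp] theorem ap_assocInvFun (v₁ : Q T Γ A₁) (v₂ : Q T Δ A₂) (v₃ : Q T Θ A₃) (s : Shuffle Δ Θ F)
    (t : Shuffle Γ F E) : ap (assocInvFun T A₁ A₂ A₃) (tensor v₁ (tensor v₂ v₃ s) t) =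
      tensor (tensor v₁ v₂ ((s.assoc t.swap).2.1.assoc (s.assoc t.swap).2.2.swap).2.1) v₃
        ((s.assoc t.swap).2.1.assoc (s.assoc t.swap).2.2.swap).2.2.swap := by
  rw [ap_assocInvFun_eq_pm, pm_tensor,
    tensor_subst_right (s₂ := .allLeft _) _ _ v₃ rfl (assoc_allLeft _),
    tensor_subst_left _ _ v₂ rfl (by rw [swap_swap]),
    tensor_subst_right (s₂ := .allLeft _) _ _ v₂ rfl (assoc_allLeft _), var_subst, var_subst]

/-- The map on tensors of a function of two arguments. -/
def uncurryFun (f : Q T [] (.hom A (.hom A' C))) : Q T [] (.hom (.tensor A A') C) :=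
  bil (app (ap f (var T)) (var T) (.right (.left .nil)))

@[simp] theorem ap_uncurryFun (f : Q T [] (.hom A (.hom A' C))) (v : Q T Γ A)
    (w : Q T Δ A') (s : Shuffle Γ Δ E) :
    ap (uncurryFun f) (tensor v w s) = app (ap f v) w s := by
  rw [uncurryFun, ap_bil, app_subst_right (s₂ := .left .nil) _ _ w rfl (assoc_allLeft (Γ := [A]) _),
    app_subst_left (s₁ := .allRight Δ) _ _ v rfl ((swap_allRight Δ).symm ▸ assoc_allLeft _),
    ap_var_subst, var_subst, swap_swap]

/-- The function of two arguments defined by a map on tensors. -/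
def curryFun (f : Q T [] (.hom (.tensor A A') C)) : Q T [] (.hom A (.hom A' C)) :=
  lam (lam (ap f (tensor (var T) (var T) (.right (.left .nil)))))

@[simp] theorem ap_curryFun (f : Q T [] (.hom (.tensor A A') C)) (v : Q T Γ A) :
    ap (curryFun f) v = lam (ap f (tensor v (var T) (.right (.allLeft Γ)))) := by
  rw [curryFun, ap_lam, lam_subst, ap_subst, tensor_subst_left (s₁ := .right (A := A') .nil) _ _ v rfl
    (assoc_allLeft (Γ := [A']) _), var_subst]
  rw [Shuffle.swap, swap_allRight]

theorem app_ap_curryFun (f : Q T [] (.hom (.tensor A A') C)) (v : Q T Γ A) (w : Q T Δ A')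
    (s : Shuffle Γ Δ E) : app (ap (curryFun f) v) w s = ap f (tensor v w s) := by
  rw [ap_curryFun, app_lam, ap_subst,
    tensor_subst_right (s₂ := .allLeft _) _ _ w rfl (assoc_allLeft _), var_subst]

theorem fun_ext {A C : Ty G} {f g : Q T [] (.hom A C)} (h : ap f (var T) = ap g (var T)) :
    f = g := hom_ext h

variable {A₄ : Ty G}

theorem fun_ext_tensor {f g : Q T [] (.hom (.tensor A₁ A₂) C)}
    (h : ap f (tensor (var T) (var T) (.right (.left .nil))) =
      ap g (tensor (var T) (var T) (.right (.left .nil)))) : f = g := hom_ext_tensor h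

theorem fun_ext_unit {f g : Q T [] (.hom .unit C)}
    (h : ap f (star T) = ap g (star T)) : f = g := hom_ext_unit h

/-- Currying trades the outermost tensor of the domain for an application. Repeating this yields the
extensionality principles below for each bracketing that occurs in the axioms of a monoidal
category. -/
theorem curryFun_injective {f g : Q T [] (.hom (.tensor A₁ A₂) C)} (h : curryFun f = curryFun g) :
    f = g := by
  refine fun_ext_tensor ?_
  rw [← app_ap_curryFun, h, app_ap_curryFun]

theorem fun_ext_unit_tensor {f g : Q T [] (.hom (.tensor .unit A) C)}
    (h : ap f (tensor (star T) (var T) (.right .nil)) =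
      ap g (tensor (star T) (var T) (.right .nil))) : f = g := by
  refine curryFun_injective (fun_ext_unit (hom_ext ?_))
  rw [app_ap_curryFun, app_ap_curryFun]
  exact h

theorem fun_ext_tensor_unit {f g : Q T [] (.hom (.tensor A .unit) C)}
    (h : ap f (tensor (var T) (star T) (.left .nil)) =
      ap g (tensor (var T) (star T) (.left .nil))) : f = g := by
  refine curryFun_injective (fun_ext (hom_ext_unit ?_))
  rw [app_ap_curryFun, app_ap_curryFun]
  exact h

theorem fun_ext_tensor_left {f g : Q T [] (.hom (.tensor (.tensor A₁ A₂) A₃) C)}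
    (h : ap f (tensor (tensor (var T) (var T) (.right (.left .nil))) (var T)
        (.right (.left (.left .nil)))) =
      ap g (tensor (tensor (var T) (var T) (.right (.left .nil))) (var T)
        (.right (.left (.left .nil))))) : f = g := by
  refine curryFun_injective (fun_ext_tensor (hom_ext ?_))
  rw [app_ap_curryFun, app_ap_curryFun]
  exact h

theorem fun_ext_tensor_right {f g : Q T [] (.hom (.tensor A₁ (.tensor A₂ A₃)) C)}
    (h : ap f (tensor (var T) (tensor (var T) (var T) (.right (.left .nil)))
        (.right (.right (.left .nil)))) =
      ap g (tensor (var T) (tensor (var T) (var T) (.right (.left .nil)))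
        (.right (.right (.left .nil))))) : f = g := by
  refine curryFun_injective (fun_ext (hom_ext_tensor ?_))
  rw [app_ap_curryFun, app_ap_curryFun]
  exact h

theorem fun_ext_tensor_unit_tensor {f g : Q T [] (.hom (.tensor (.tensor A₁ .unit) A₂) C)}
    (h : ap f (tensor (tensor (var T) (star T) (.left .nil)) (var T) (.right (.left .nil))) =
      ap g (tensor (tensor (var T) (star T) (.left .nil)) (var T) (.right (.left .nil)))) :
    f = g := by
  refine curryFun_injective (fun_ext_tensor_unit (hom_ext ?_))
  rw [app_ap_curryFun, app_ap_curryFun]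
  exact h

theorem fun_ext_tensor_left_left
    {f g : Q T [] (.hom (.tensor (.tensor (.tensor A₁ A₂) A₃) A₄) C)}
    (h : ap f (tensor (tensor (tensor (var T) (var T) (.right (.left .nil))) (var T)
        (.right (.left (.left .nil)))) (var T) (.right (.left (.left (.left .nil))))) =
      ap g (tensor (tensor (tensor (var T) (var T) (.right (.left .nil))) (var T)
        (.right (.left (.left .nil)))) (var T) (.right (.left (.left (.left .nil)))))) :
    f = g := by
  refine curryFun_injective (fun_ext_tensor_left (hom_ext ?_))
  rw [app_ap_curryFun, app_ap_curryFun]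
  exact h

/-- On variables all contexts are explicit lists, so the rebracketed shuffles evaluate and the two
sides coincide. -/
theorem assocFun_comp_assocInvFun (A₁ A₂ A₃ : Ty G) :
    compFun (assocFun T A₁ A₂ A₃) (assocInvFun T A₁ A₂ A₃) = idFun T _ :=
  fun_ext_tensor_left (by simp only [ap_compFun, ap_idFun, ap_assocFun, ap_assocInvFun]; rfl)

theorem assocInvFun_comp_assocFun (A₁ A₂ A₃ : Ty G) :
    compFun (assocInvFun T A₁ A₂ A₃) (assocFun T A₁ A₂ A₃) = idFun T _ :=
  fun_ext_tensor_right (by simp only [ap_compFun, ap_idFun, ap_assocFun, ap_assocInvFun]; rfl)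

theorem swapFun_comp_swapFun (A₁ A₂ : Ty G) :
    compFun (swapFun T A₁ A₂) (swapFun T A₂ A₁) = idFun T _ :=
  fun_ext_tensor (by simp only [ap_compFun, ap_idFun, ap_swapFun]; rfl)

variable (T) in
/-- Discarding as a function. -/
def disFun (A : Ty G) : Q T [] (.hom A .unit) :=
  lam (dis (var T))

/-- Every `w : I` equals `w to *. *`, and the second equation for `dis` says that `v` and `dis(v)`
give the same such term. -/
theorem dis_unit_eq {Γ : Ctx G} (v : Q T Γ .unit) : dis v = v := by
  have h (w : Q T Γ .unit) : unitE w (star T) (.allLeft Γ) = w := by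
    -- The η-rule of the unit for the term `z`.
    have h := unitE_subst_star w (var T) .here (.allLeft Γ)
    rw [Shuffle.swap_allLeft, var_subst] at h
    exact (congrArg (fun u => unitE w u (.allLeft Γ)) (var_subst (star T)).symm).trans h
  exact (h _).symm.trans ((unitE_dis_star v).symm.trans (h _))

/-- Both terms equal their own `dis`, and `dis` depends only on the context. -/
theorem unit_ext {Γ : Ctx G} (f g : Q T Γ .unit) : f = g := by
  rw [← dis_unit_eq f, dis_eq_dis f g, dis_unit_eq]

theorem mul_dist_compFun_le (f f' : Q T [] (.hom A C)) (g g' : Q T [] (.hom C D)) :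
    dist f f' * dist g g' ≤ dist (compFun f g) (compFun f' g') := by
  refine le_trans ?_ (dist_lam_le _ _)
  rw [mul_comm]
  exact (mul_le_mul' le_rfl (dist_app_le _ _ _ _)).trans (mul_dist_app_le _ _ _ _ _)

theorem mul_dist_tensorFun_le (f f' : Q T [] (.hom A C)) (g g' : Q T [] (.hom A' D)) :
    dist f f' * dist g g' ≤ dist (tensorFun f g) (tensorFun f' g') :=
  (mul_le_mul' (dist_app_le _ _ _ _) (dist_app_le _ _ _ _)).trans
    ((mul_dist_tensor_le _ _ _ _ _).trans ((dist_pm_le _ _ _ _).trans (dist_lam_le _ _)))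

/-- `curryFun` is built from operations that do not decrease `dist`, and so is the recovery of `f (x
⊗ y)` from it; `f (x ⊗ y)` determines `f` by extensionality. -/
theorem dist_curryFun (f f' : Q T [] (.hom (.tensor A A') C)) :
    dist (curryFun f) (curryFun f') = dist f f' := by
  refine le_antisymm (le_trans ?_ (dist_le_of_app_tensor _ _))
    ((dist_app_le _ _ _ _).trans ((dist_lam_le _ _).trans (dist_lam_le _ _)))
  change _ ≤ dist (ap f _) (ap f' _)
  rw [← app_ap_curryFun f, ← app_ap_curryFun f']
  exact (dist_app_le _ _ _ _).trans (dist_app_le _ _ _ _)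

theorem dist_compFun_swapFun (f f' : Q T [] (.hom (.tensor A A') C)) :
    dist (compFun (swapFun T A' A) f) (compFun (swapFun T A' A) f') = dist f f' := by
  have h {A₁ A₂ : Ty G} (f f' : Q T [] (.hom (.tensor A₁ A₂) C)) :
      dist f f' ≤ dist (compFun (swapFun T A₂ A₁) f) (compFun (swapFun T A₂ A₁) f') :=
    dist_le_of_mul_left (one_le_dist_self _) (mul_dist_compFun_le _ _ _ _)
  -- Precomposing with the symmetry twice is the identity, so the inequality `h`, used in both
  -- directions, is an equality.
  have h' (f : Q T [] (.hom (.tensor A A') C)) :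
      compFun (swapFun T A A') (compFun (swapFun T A' A) f) = f :=
    fun_ext_tensor (by simp)
  refine le_antisymm ((h _ _).trans_eq ?_) (h _ _)
  rw [h', h']

end Q

end ClosedFunctions

-- The syntactic category as an enriched affine category

section SyntacticCategory

variable {V : Type x} [CommMonoid V] [CompleteLattice V] [IsQuantale V] {B : Set V} {G : Type u}
  {S : Signature.{u, u'} G}

/-- The objects of the syntactic category. -/
structure SynObj (T : AffineTheory V B S) : Type (max u w) where
  ty : Ty G

variable {T : AffineTheory V B S} [T.Integral]
  [∀ A C : Ty G, Small.{v} (Q T [] (.hom A C))]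

open Q

/-- The syntactic category: its morphisms are the functions without free variables. -/
noncomputable instance : CategoryStruct.{v} (SynObj.{x, u, u', w} T) where
  Hom X Y := Shrink.{v} (Q T [] (.hom X.ty Y.ty))
  id X := equivShrink _ (idFun T X.ty)
  comp f g := equivShrink _ (compFun ((equivShrink _).symm f) ((equivShrink _).symm g))

namespace SynObj

variable {W X Y Z X' Y' Z' : SynObj.{x, u, u', w} T} {Γ Δ E : Ctx G}

/-- The function underlying a morphism. -/
noncomputable def fn (f : X ⟶ Y) : Q T [] (.hom X.ty Y.ty) := (equivShrink _).symm f

/-- The morphism defined by a function. -/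
noncomputable def ofFn (f : Q T [] (.hom X.ty Y.ty)) : X ⟶ Y := equivShrink _ f

@[simp] theorem fn_ofFn (f : Q T [] (.hom X.ty Y.ty)) : fn (ofFn f : X ⟶ Y) = f :=
  (equivShrink _).symm_apply_apply f

@[simp] theorem fn_id : fn (𝟙 X) = idFun T X.ty := fn_ofFn _

@[simp] theorem fn_comp (f : X ⟶ Y) (g : Y ⟶ Z) : fn (f ≫ g) = compFun (fn f) (fn g) := fn_ofFn _

theorem ext_fn {f g : X ⟶ Y} (h : fn f = fn g) : f = g := (equivShrink _).symm.injective h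

/-- The action of a morphism on terms. -/
noncomputable def act (f : X ⟶ Y) (v : Q T Γ X.ty) : Q T Γ Y.ty := ap (fn f) v

@[simp] theorem act_ofFn (f : Q T [] (.hom X.ty Y.ty)) (v : Q T Γ X.ty) :
    act (ofFn f : X ⟶ Y) v = ap f v := by
  rw [act, fn_ofFn]

@[simp] theorem act_id (v : Q T Γ X.ty) : act (𝟙 X) v = v := by simp [act]

@[simp] theorem act_comp (f : X ⟶ Y) (g : Y ⟶ Z) (v : Q T Γ X.ty) :
    act (f ≫ g) v = act g (act f v) := by simp [act]

end SynObj

open SynObj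

theorem SynObj.ext_act {X Y : SynObj.{x, u, u', w} T} {f g : X ⟶ Y}
    (h : act f (var T) = act g (var T)) : f = g :=
  ext_fn (fun_ext h)

noncomputable instance : Category.{v} (SynObj.{x, u, u', w} T) where
  id_comp f := ext_act (by simp)
  comp_id f := ext_act (by simp)
  assoc f g h := ext_act (by simp)

/-- A pair of inverse functions. -/
noncomputable def SynObj.isoOfFn {X Y : SynObj.{x, u, u', w} T} (f : Q T [] (.hom X.ty Y.ty))
    (g : Q T [] (.hom Y.ty X.ty)) (h : compFun f g = idFun T X.ty)
    (h' : compFun g f = idFun T Y.ty) : X ≅ Y where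
  hom := ofFn f
  inv := ofFn g
  hom_inv_id := ext_fn (by simp [h])
  inv_hom_id := ext_fn (by simp [h'])

noncomputable instance : MonoidalCategoryStruct.{v} (SynObj.{x, u, u', w} T) where
  tensorObj X Y := ⟨.tensor X.ty Y.ty⟩
  tensorUnit := ⟨.unit⟩
  tensorHom f g := ofFn (tensorFun (fn f) (fn g))
  whiskerLeft X _ _ f := ofFn (tensorFun (idFun T X.ty) (fn f))
  whiskerRight f X := ofFn (tensorFun (fn f) (idFun T X.ty))
  associator X Y Z := isoOfFn (assocFun T X.ty Y.ty Z.ty) (assocInvFun T X.ty Y.ty Z.ty)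
    (assocFun_comp_assocInvFun _ _ _) (assocInvFun_comp_assocFun _ _ _)
  leftUnitor X := isoOfFn (leftUnitFun T X.ty) (leftUnitInvFun T X.ty)
    (fun_ext_unit_tensor (by
      simp only [ap_compFun, ap_idFun, ap_leftUnitInvFun, ap_leftUnitFun]
      exact congrArg (fun v => tensor (star T) v (.right .nil)) (unitE_star (var T))))
    (fun_ext (by simp only [ap_compFun, ap_idFun, ap_leftUnitInvFun, ap_leftUnitFun, unitE_star]))
  rightUnitor X := isoOfFn (rightUnitFun T X.ty) (rightUnitInvFun T X.ty)
    (fun_ext_tensor_unit (by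
      simp only [ap_compFun, ap_idFun, ap_rightUnitInvFun, ap_rightUnitFun]
      exact congrArg (fun v => tensor v (star T) (.left .nil)) (unitE_star (var T))))
    (fun_ext (by
      simp only [ap_compFun, ap_idFun, ap_rightUnitInvFun, ap_rightUnitFun]
      exact unitE_star (var T)))

namespace SynObj

variable {W X Y Z X' Y' Z' : SynObj.{x, u, u', w} T} {Γ Δ Θ E F : Ctx G}

theorem ext_tensor {f g : X ⊗ Y ⟶ Z}
    (h : act f (tensor (var T) (var T) (.right (.left .nil))) =
      act g (tensor (var T) (var T) (.right (.left .nil)))) : f = g :=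
  ext_fn (fun_ext_tensor h)

@[simp] theorem act_tensorHom (f : X ⟶ X') (g : Y ⟶ Y') (v : Q T Γ X.ty) (w : Q T Δ Y.ty)
    (s : Shuffle Γ Δ E) :
    act (f ⊗ₘ g) (tensor v w s : Q T E (X ⊗ Y).ty) = tensor (act f v) (act g w) s :=
  (act_ofFn _ _).trans (ap_tensorFun _ _ _ _ _)

@[simp] theorem act_whiskerLeft (g : Y ⟶ Y') (v : Q T Γ X.ty) (w : Q T Δ Y.ty)
    (s : Shuffle Γ Δ E) :
    act (X ◁ g) (tensor v w s : Q T E (X ⊗ Y).ty) = tensor v (act g w) s :=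
  (act_ofFn _ _).trans ((ap_tensorFun _ _ _ _ _).trans (by rw [ap_idFun]; rfl))

@[simp] theorem act_whiskerRight (f : X ⟶ X') (v : Q T Γ X.ty) (w : Q T Δ Y.ty)
    (s : Shuffle Γ Δ E) :
    act (f ▷ Y) (tensor v w s : Q T E (X ⊗ Y).ty) = tensor (act f v) w s :=
  (act_ofFn _ _).trans ((ap_tensorFun _ _ _ _ _).trans (by rw [ap_idFun]; rfl))

@[simp] theorem act_associator_hom (v₁ : Q T Γ X.ty) (v₂ : Q T Δ Y.ty) (s : Shuffle Γ Δ F)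
    (v₃ : Q T Θ Z.ty) (t : Shuffle F Θ E) :
    act (α_ X Y Z).hom (tensor (tensor v₁ v₂ s) v₃ t : Q T E ((X ⊗ Y) ⊗ Z).ty) =
      tensor v₁ (tensor v₂ v₃ (s.assoc t).2.1) (s.assoc t).2.2 :=
  (act_ofFn _ _).trans (ap_assocFun _ _ _ _ _)

@[simp] theorem act_unitE (f : X ⟶ Y) (v : Q T Γ .unit) (w : Q T Δ X.ty) (s : Shuffle Γ Δ E) :
    act f (unitE v w s) = unitE v (act f w) s := ap_unitE _ _ _ _

theorem act_pm {A A' : Ty G} (f : X ⟶ Y) (v : Q T Γ (.tensor A A')) (w : Q T (A' :: A :: Δ) X.ty)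
    (s : Shuffle Γ Δ E) : act f (pm v w s) = pm v (act f w) s := ap_pm _ _ _ _

@[simp] theorem act_leftUnitor_hom (v : Q T Γ .unit) (w : Q T Δ X.ty) (s : Shuffle Γ Δ E) :
    act (λ_ X).hom (tensor v w s : Q T E (𝟙_ _ ⊗ X).ty) = unitE v w s :=
  (act_ofFn _ _).trans (ap_leftUnitFun _ _ _)

@[simp] theorem act_leftUnitor_inv (v : Q T Γ X.ty) :
    act (λ_ X).inv v = tensor (star T) v (.allRight Γ) :=
  (act_ofFn _ _).trans (ap_leftUnitInvFun _)

@[simp] theorem act_rightUnitor_hom (v : Q T Γ X.ty) (w : Q T Δ .unit) (s : Shuffle Γ Δ E) :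
    act (ρ_ X).hom (tensor v w s : Q T E (X ⊗ 𝟙_ _).ty) = unitE w v s.swap :=
  (act_ofFn _ _).trans (ap_rightUnitFun _ _ _)

end SynObj

/-- Every axiom is tested on the tensor of variables and `*` that matches the bracketing of the
domain. The pentagon ends in an evaluation of shuffles; the triangle also needs `* to *. x = x` on
both sides. -/
noncomputable instance : MonoidalCategory.{v} (SynObj.{x, u, u', w} T) :=
  .ofTensorHom
    (id_tensorHom_id := fun _ _ => ext_tensor (by simp))
    (id_tensorHom := fun _ _ _ _ => ext_tensor (by simp))
    (tensorHom_id := fun _ _ => ext_tensor (by simp))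
    (tensorHom_comp_tensorHom := fun _ _ _ _ => ext_tensor (by simp))
    (associator_naturality := fun _ _ _ => ext_fn (fun_ext_tensor_left (by change act _ _ = act _ _; simp)))
    (leftUnitor_naturality := fun _ => ext_fn (fun_ext_unit_tensor (by change act _ _ = act _ _; simp)))
    (rightUnitor_naturality := fun _ => ext_fn (fun_ext_tensor_unit (by change act _ _ = act _ _; simp)))
    (pentagon := fun _ _ _ _ => ext_fn (fun_ext_tensor_left_left (by
      change act _ _ = act _ _; simp; rfl)))
    (triangle := fun _ _ => ext_fn (fun_ext_tensor_unit_tensor (by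
      change act _ _ = act _ _
      simp only [act_comp, act_tensorHom, act_associator_hom, act_id, act_leftUnitor_hom,
        act_rightUnitor_hom]
      exact (congrArg (fun v => tensor (var T) v (.right (.left .nil))) (unitE_star (var T))).trans
        (congrArg (fun v => tensor v (var T) (.right (.left .nil))) (unitE_star (var T))).symm)))

noncomputable instance : SemiCartesianMonoidalCategory.{v} (SynObj.{x, u, u', w} T) where
  isTerminalTensorUnit := Limits.IsTerminal.ofUniqueHom (fun X => ofFn (disFun T X.ty))
    fun _ _ => ext_act (unit_ext _ _)
  fst X Y := X ◁ ofFn (disFun T Y.ty) ≫ (ρ_ X).hom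
  snd X Y := ofFn (disFun T X.ty) ▷ Y ≫ (λ_ Y).hom
  fst_def _ _ := rfl
  snd_def _ _ := rfl

/-- The symmetry of the syntactic category. -/
noncomputable def SynObj.swapIso (X Y : SynObj.{x, u, u', w} T) : X ⊗ Y ≅ Y ⊗ X :=
  isoOfFn (swapFun T X.ty Y.ty) (swapFun T Y.ty X.ty)
    (swapFun_comp_swapFun _ _) (swapFun_comp_swapFun _ _)

@[simp] theorem SynObj.act_swapIso {X Y : SynObj.{x, u, u', w} T} {Γ Δ E : Ctx G}
    (v : Q T Γ X.ty) (w : Q T Δ Y.ty) (s : Shuffle Γ Δ E) :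
    act (swapIso X Y).hom (tensor v w s : Q T E (X ⊗ Y).ty) = tensor w v s.swap :=
  (act_ofFn _ _).trans (ap_swapFun _ _ _)

theorem SynObj.swapIso_hexagon_forward (X Y Z : SynObj.{x, u, u', w} T) :
    (α_ X Y Z).hom ≫ (swapIso X (Y ⊗ Z)).hom ≫ (α_ Y Z X).hom =
      (swapIso X Y).hom ▷ Z ≫ (α_ Y X Z).hom ≫ Y ◁ (swapIso X Z).hom := by
  refine ext_fn (fun_ext_tensor_left ?_)
  change act _ _ = act _ _
  simp only [act_comp, act_associator_hom, act_swapIso, act_whiskerRight, act_whiskerLeft]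
  rfl

/-- The symmetry is inverse to itself, so this is the inverse of the forward hexagon for `Z, X, Y`.
-/
theorem SynObj.swapIso_hexagon_reverse (X Y Z : SynObj.{x, u, u', w} T) :
    (α_ X Y Z).inv ≫ (swapIso (X ⊗ Y) Z).hom ≫ (α_ Z X Y).inv =
      X ◁ (swapIso Y Z).hom ≫ (α_ X Z Y).inv ≫ (swapIso X Z).hom ▷ Y := by
  have h : α_ Z X Y ≪≫ swapIso Z (X ⊗ Y) ≪≫ α_ X Y Z =
      whiskerRightIso (swapIso Z X) Y ≪≫ α_ X Z Y ≪≫ whiskerLeftIso X (swapIso Z Y) :=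
    Iso.ext (swapIso_hexagon_forward Z X Y)
  have h' := congrArg Iso.inv h
  simp only [Iso.trans_inv, Category.assoc] at h'
  exact h'

noncomputable instance : SymmetricCategory.{v} (SynObj.{x, u, u', w} T) where
  braiding := swapIso
  braiding_naturality_right X _ _ f := ext_tensor (by simp)
  braiding_naturality_left f X := ext_tensor (by simp)
  hexagon_forward := swapIso_hexagon_forward
  hexagon_reverse := swapIso_hexagon_reverse
  symmetry X Y := ext_tensor (by
    change act ((swapIso X Y).hom ≫ (swapIso Y X).hom) _ = _
    simp)

@[simp] theorem SynObj.act_braiding {X Y : SynObj.{x, u, u', w} T} {Γ Δ E : Ctx G}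
    (v : Q T Γ X.ty) (w : Q T Δ Y.ty) (s : Shuffle Γ Δ E) :
    act (β_ X Y).hom (tensor v w s : Q T E (X ⊗ Y).ty) = tensor w v s.swap :=
  act_swapIso _ _ _

/-- Currying in the syntactic category. -/
noncomputable def SynObj.curryEquiv (X Y Z : SynObj.{x, u, u', w} T) :
    (X ⊗ Y ⟶ Z) ≃ (Y ⟶ (⟨.hom X.ty Z.ty⟩ : SynObj.{x, u, u', w} T)) where
  -- The symmetry is needed because `curryFun` abstracts the right factor, whereas the adjunction `X
  -- ⊗ - ⊣ ihom X` transposes the left one.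
  toFun f := ofFn (curryFun (compFun (swapFun T Y.ty X.ty) (fn f)))
  invFun g := ofFn (compFun (swapFun T X.ty Y.ty) (uncurryFun (fn g)))
  left_inv f := ext_tensor (by
    rw [act_ofFn, fn_ofFn, ap_compFun, ap_swapFun, ap_uncurryFun, app_ap_curryFun, ap_compFun,
      ap_swapFun]
    rfl)
  right_inv g := ext_fn (fun_ext (by
    rw [fn_ofFn, fn_ofFn]
    refine hom_ext ?_
    rw [app_ap_curryFun, ap_compFun, ap_compFun, ap_swapFun, ap_swapFun, Shuffle.swap_swap,
      ap_uncurryFun]))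

theorem SynObj.app_act_curryEquiv {X Y Z : SynObj.{x, u, u', w} T} {Γ Δ E : Ctx G} (f : X ⊗ Y ⟶ Z)
    (v : Q T Γ Y.ty) (w : Q T Δ X.ty) (s : Shuffle Γ Δ E) :
    app (act (curryEquiv X Y Z f) v) w s = act f (tensor w v s.swap : Q T E (X ⊗ Y).ty) := by
  refine (congrArg (fun u => app u w s) (act_ofFn _ v)).trans ?_
  rw [app_ap_curryFun, ap_compFun, ap_swapFun]
  rfl

theorem SynObj.curryEquiv_comp (X X' Y Z : SynObj.{x, u, u', w} T) (f : X' ⟶ Y) (g : X ⊗ Y ⟶ Z) :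
    curryEquiv X X' Z (X ◁ f ≫ g) = f ≫ curryEquiv X Y Z g := by
  refine ext_act (hom_ext ?_)
  have h := app_act_curryEquiv (X ◁ f ≫ g) (var T) (var T) (.right (.allLeft [X'.ty]))
  rw [act_comp, act_whiskerLeft] at h
  rw [act_comp]
  exact h.trans (app_act_curryEquiv g (act f (var T)) (var T) _).symm

theorem SynObj.curryEquiv_symm_comp (X X' Y Z : SynObj.{x, u, u', w} T) (f : X' ⟶ Y)
    (g : Y ⟶ ⟨.hom X.ty Z.ty⟩) :
    (curryEquiv X X' Z).symm (f ≫ g) = X ◁ f ≫ (curryEquiv X Y Z).symm g := by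
  rw [Equiv.symm_apply_eq, curryEquiv_comp, Equiv.apply_symm_apply]

/-- The hom-set bijections of the tensor-hom adjunction. -/
noncomputable def SynObj.curryCore (X : SynObj.{x, u, u', w} T) :
    Adjunction.CoreHomEquiv (tensorLeft X) (Adjunction.rightAdjointOfEquiv (F := tensorLeft X)
      (curryEquiv X) (fun _ _ _ => curryEquiv_comp X _ _ _)) where
  homEquiv := curryEquiv X
  homEquiv_naturality_left_symm := curryEquiv_symm_comp X _ _ _
  homEquiv_naturality_right {Y Z Z'} f g := by
    -- The right adjoint sends `g` to the transpose of the counit followed by `g`, so naturality on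
    -- the right is an instance of naturality on the left.
    refine Eq.trans ?_ (curryEquiv_comp X Y _ Z' (curryEquiv X Y Z f) _)
    rw [← Category.assoc, ← curryEquiv_symm_comp, Category.comp_id, Equiv.symm_apply_apply]

noncomputable instance : MonoidalClosed.{v} (SynObj.{x, u, u', w} T) where
  closed X :=
    { rightAdj := _
      adj := .mkOfHomEquiv (curryCore X) }

theorem SynObj.curry_eq {X Y Z : SynObj.{x, u, u', w} T} (f : X ⊗ Y ⟶ Z) :
    MonoidalClosed.curry f = curryEquiv X Y Z f :=
  congrArg (fun e : (∀ Y Z, ((tensorLeft X).obj Y ⟶ Z) ≃ _) => e Y Z f)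
    (Adjunction.mkOfHomEquiv_homEquiv (curryCore X))

theorem SynObj.act_ev {X Z : SynObj.{x, u, u', w} T} {Γ Δ E : Ctx G} (v : Q T Γ X.ty)
    (w : Q T Δ (.hom X.ty Z.ty)) (s : Shuffle Γ Δ E) :
    act ((ihom.ev X).app Z) (tensor v w s : Q T E (X ⊗ (ihom X).obj Z).ty) = app w v s.swap := by
  -- Evaluation enters only through its characterisation as the morphism whose transpose is the
  -- identity.
  have key (k : X ⊗ ⟨.hom X.ty Z.ty⟩ ⟶ Z) (hk : curryEquiv X ⟨.hom X.ty Z.ty⟩ Z k = 𝟙 _) :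
      act k (tensor v w s : Q T E (X ⊗ ⟨.hom X.ty Z.ty⟩).ty) = app w v s.swap := by
    have h := app_act_curryEquiv k w v s.swap
    rw [Shuffle.swap_swap, hk, act_id] at h
    exact h.symm
  refine key _ ?_
  exact (curry_eq _).symm.trans ((congrArg MonoidalClosed.curry
    (MonoidalClosed.uncurry_id_eq_ev X Z).symm).trans (MonoidalClosed.curry_uncurry _))

/-- The syntactic category is enriched. -/
noncomputable instance : EnrichedAffine V (SynObj.{x, u, u', w} T) where
  hdist f g := dist (fn f) (fn g)
  isVCategory _ _ := ⟨fun _ => one_le_dist_self _, fun _ _ _ => dist_trans _ _ _⟩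
  isSeparated _ _ _ _ h h' := ext_fn (eq_of_dist h h')
  comp_le f f' g g' := by
    rw [fn_comp, fn_comp]
    exact mul_dist_compFun_le _ _ _ _
  tensor_le f f' g g' :=
    (mul_dist_tensorFun_le _ _ _ _).trans_eq (congrArg₂ Q.dist (fn_ofFn _).symm (fn_ofFn _).symm)
  curry_eq f g := by
    rw [SynObj.curry_eq, SynObj.curry_eq]
    exact (congrArg₂ Q.dist (fn_ofFn _) (fn_ofFn _)).trans
      ((dist_curryFun _ _).trans (dist_compFun_swapFun _ _))

end SyntacticCategory

-- Transport along equalities of types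

section Cast

variable {V : Type x} [CommMonoid V] [CompleteLattice V] [IsQuantale V] {B : Set V} {G : Type u}
  {S : Signature.{u, u'} G} {T : AffineTheory V B S} [T.Integral]

namespace Q

variable {Γ Δ E : Ctx G} {A A' C C' D X : Ty G}

/-- Transport along an equality of types. -/
def cast (h : A = A') (v : Q T Γ A) : Q T Γ A' := h ▸ v

theorem dist_cast (h : A = A') (v w : Q T Γ A) : dist (cast h v) (cast h w) = dist v w := by
  subst h; rfl

/-- In the syntactic category a type and its interpretation are equal but not definitionally so.
Stating the compatibility of casts with the term formers for arbitrary equalities allows these to be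
eliminated. -/
theorem tensor_cast (h : A = A') (h' : C = C') (e : Ty.tensor A C = Ty.tensor A' C')
    (v : Q T Γ A) (w : Q T Δ C) (s : Shuffle Γ Δ E) :
    tensor (cast h v) (cast h' w) s = cast e (tensor v w s) := by
  subst h h'; rfl

theorem unitE_cast (h : A = A') (v : Q T Γ .unit) (w : Q T Δ A) (s : Shuffle Γ Δ E) :
    unitE v (cast h w) s = cast h (unitE v w s) := by
  subst h; rfl

theorem pm_cast (h : X = D) (v : Q T Γ (.tensor A C)) (w : Q T (C :: A :: Δ) X)
    (s : Shuffle Γ Δ E) : pm v (cast h w) s = cast h (pm v w s) := by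
  subst h; rfl

theorem app_cast (h : A = A') (h' : C = C') (e : Ty.hom A C = Ty.hom A' C')
    (v : Q T Γ (.hom A C)) (w : Q T Δ A) (s : Shuffle Γ Δ E) :
    app (cast e v) (cast h w) s = cast h' (app v w s) := by
  subst h h'; rfl

theorem ap_cast (h : C = C') (e : Ty.hom A C = Ty.hom A C') (f : Q T [] (.hom A C)) (v : Q T Γ A) :
    ap (cast e f) v = cast h (ap f v) := by
  subst h; rfl

theorem ap_curryFun_cast (h : A = A') (h' : C = C') (e : Ty.hom A C = Ty.hom A' C')
    (f : Q T [] (.hom (.tensor D A') C')) (v : Q T Γ D) (w : Q T (A :: Γ) C)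
    (hw : ap f (tensor v (cast h (var T)) (.right (.allLeft Γ))) = cast h' w) :
    ap (curryFun f) v = cast e (lam w) := by
  subst h h'
  exact (ap_curryFun f v).trans (congrArg lam hw)

theorem ap_assocInvFun_cast (h : A = A') (h' : C = C') (e : Ty.tensor A C = Ty.tensor A' C')
    (v : Q T Γ D) (w : Q T Δ (.tensor A C)) (s : Shuffle Γ Δ E) :
    ap (assocInvFun T D A' C') (tensor v (cast e w) s) = pm w (tensor (tensor v (cast h (var T))
      (.right (.allLeft Γ))) (cast h' (var T)) (.right (.allLeft (A :: Γ)))) s.swap := by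
  subst h h'
  exact ap_assocInvFun_eq_pm _ _ _

theorem exists_ap_star (v : Q T [] C) : ∃ k : Q T [] (.hom .unit C), ap k (star T) = v := by
  refine ⟨lam (unitE (var T) v (.left .nil)), ?_⟩
  rw [ap_lam, unitE_subst_left (s₁ := .nil) (var T) v (star T) rfl
    (Shuffle.assoc_allRight (Γ := []) _)]
  exact (congrArg (fun u => unitE u v .nil) (var_subst (star T))).trans (unitE_star v)

theorem dist_le_of_app_cast_var (h : A = A') (u u' : Q T Γ (.hom A' C)) :
    dist (app u (cast h (var T)) (.right (.allLeft Γ)))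
      (app u' (cast h (var T)) (.right (.allLeft Γ))) ≤ dist u u' := by
  subst h
  exact dist_le_of_app_var _ _

theorem exists_ap_tensor_cast (h : A = A') (f : Q T [] (.hom D (.hom A C))) :
    ∃ g : Q T [] (.hom (.tensor D A') C), ∀ {Γ Δ E : Ctx G} (v : Q T Γ D) (w : Q T Δ A)
      (s : Shuffle Γ Δ E), ap g (tensor v (cast h w) s) = app (ap f v) w s := by
  subst h
  exact ⟨uncurryFun f, fun _ _ _ => ap_uncurryFun _ _ _ _⟩

end Q

end Cast

-- Completeness: the interpretation in the syntactic category

section Completeness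

variable {V : Type x} [CommMonoid V] [CompleteLattice V] [IsQuantale V] {B : Set V} {G : Type u}
  {S : Signature.{u, u'} G} (T : AffineTheory V B S) [T.Integral]
  [∀ A C : Ty G, Small.{v} (Q T [] (.hom A C))]

open Q SynObj

/-- The ground types as objects of the syntactic category. -/
def synOb (X : G) : SynObj.{x, u, u', w} T := ⟨.ground X⟩

theorem ty_tyObj : (A : Ty G) → (tyObj (synOb.{x, u, u', w} T) A).ty = A
  | .ground _ => rfl
  | .unit => rfl
  | .tensor A C => congrArg₂ Ty.tensor (ty_tyObj A) (ty_tyObj C)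
  | .hom A C => congrArg₂ Ty.hom (ty_tyObj A) (ty_tyObj C)

/-- The class of a term, with the interpretation of its type as type. -/
noncomputable def toObj {Γ : Ctx G} {A : Ty G} (v : Q T Γ A) : Q T Γ (tyObj (synOb.{x, u, u', w} T) A).ty :=
  cast (ty_tyObj.{x, u, u', v, w} T A).symm v

/-- The tuple of all variables of a context. -/
noncomputable def tup : (Γ : Ctx G) → Q T Γ (ctxObj (synOb.{x, u, u', w} T) Γ).ty
  | [] => star T
  | [A] => toObj T (A := A) (var T)
  | A :: C :: Γ => tensor (tup (C :: Γ)) (toObj T (A := A) (var T)) (.right (.allLeft (C :: Γ)))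

theorem act_snocIso_inv_tup (Γ : Ctx G) (A : Ty G) :
    act (snocIso (synOb.{x, u, u', w} T) Γ A).inv
      (tensor (tup T Γ) (toObj T (A := A) (var T)) (.right (.allLeft Γ)) :
        Q T (A :: Γ) (ctxObj (synOb T) Γ ⊗ tyObj (synOb T) A).ty) = tup T (A :: Γ) := by
  cases Γ with
  | nil => exact (act_leftUnitor_hom _ _ _).trans (unitE_star _)
  | cons C Γ => exact act_id _

theorem act_snocIso_hom_inv {Γ E : Ctx G} {A : Ty G}
    (z : Q T E (ctxObj (synOb.{x, u, u', w} T) Γ ⊗ tyObj (synOb T) A).ty) :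
    act (snocIso (synOb T) Γ A).hom (act (snocIso (synOb T) Γ A).inv z) = z := by
  rw [← act_comp, Iso.inv_hom_id, act_id]

theorem act_snocIso_hom_tup (Γ : Ctx G) (A : Ty G) :
    act (snocIso (synOb.{x, u, u', w} T) Γ A).hom (tup T (A :: Γ)) =
      tensor (tup T Γ) (toObj T (A := A) (var T)) (.right (.allLeft Γ)) := by
  rw [← act_snocIso_inv_tup]
  exact act_snocIso_hom_inv T _

variable {T} in
theorem act_associator_hom_of_eq {X Y Z : SynObj.{x, u, u', w} T} {Γ Δ Θ E F K : Ctx G}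
    (v₁ : Q T Γ X.ty) (v₂ : Q T Δ Y.ty) (s : Shuffle Γ Δ F) (v₃ : Q T Θ Z.ty) (t : Shuffle F Θ E)
    {a : Shuffle Δ Θ K} {b : Shuffle Γ K E} (h : s.assoc t = ⟨K, a, b⟩) :
    act (α_ X Y Z).hom (tensor (tensor v₁ v₂ s) v₃ t : Q T E ((X ⊗ Y) ⊗ Z).ty) =
      tensor v₁ (tensor v₂ v₃ a) b := by
  rw [act_associator_hom, h]

variable {T} in
theorem act_associator_inv_of_eq {X Y Z : SynObj.{x, u, u', w} T} {Γ Δ Θ E F K : Ctx G}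
    (v₁ : Q T Γ X.ty) (v₂ : Q T Δ Y.ty) (v₃ : Q T Θ Z.ty) (s : Shuffle Γ Δ F) (t : Shuffle F Θ E)
    {a : Shuffle Δ Θ K} {b : Shuffle Γ K E} (h : s.assoc t = ⟨K, a, b⟩) :
    act (α_ X Y Z).inv (tensor v₁ (tensor v₂ v₃ a) b : Q T E (X ⊗ Y ⊗ Z).ty) =
      tensor (tensor v₁ v₂ s) v₃ t := by
  rw [← act_associator_hom_of_eq v₁ v₂ s v₃ t h, ← act_comp, Iso.hom_inv_id, act_id]

theorem assoc_right_allLeft {α : Type u} {Γ Δ E : List α} {A : α} (s : Shuffle Γ Δ E) :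
    s.assoc (.right (A := A) (.allLeft E)) = ⟨_, .right (.allLeft Δ), .right s⟩ := by
  simp only [Shuffle.assoc_right]
  rw [Shuffle.assoc_allLeft_right]

/-- On the tuple of variables the splitting morphism does nothing but record the shuffle in the
tensor. This makes each clause of the interpretation computable on terms. -/
theorem act_splitHom_tup {Γ Δ E : Ctx G} (s : Shuffle Γ Δ E) :
    act (splitHom (synOb.{x, u, u', w} T) s) (tup T E) = tensor (tup T Γ) (tup T Δ) s := by
  induction s with
  | nil => exact act_leftUnitor_inv _
  | @left A Γ Δ E s ih =>
    have h : (Shuffle.right (A := A) (.allLeft Γ)).assoc (.left s) =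
        ⟨_, .left (.allRight Δ), .right s⟩ := by
      simp only [Shuffle.assoc]
      rw [Shuffle.assoc_allLeft]
    rw [splitHom, act_comp, act_snocIso_hom_tup, act_comp, act_whiskerRight, ih, act_comp,
      act_associator_hom_of_eq _ _ _ _ _ (assoc_right_allLeft s), act_comp, act_whiskerLeft,
      act_braiding, Shuffle.swap, Shuffle.swap_allLeft, act_comp,
      act_associator_inv_of_eq _ _ _ _ _ h, act_whiskerRight, act_snocIso_inv_tup]
  | @right A Γ Δ E s ih =>
    rw [splitHom, act_comp, act_snocIso_hom_tup, act_comp, act_whiskerRight, ih, act_comp,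
      act_associator_hom_of_eq _ _ _ _ _ (assoc_right_allLeft s), act_whiskerLeft,
      act_snocIso_inv_tup]

/-- The tuple of a family of arguments. -/
noncomputable def tupArgs : {E : Ctx G} → {As : List (Ty G)} → Args S E As →
    Q T E (ctxObj (synOb.{x, u, u', w} T) As).ty
  | _, _, .nil => star T
  | _, _, .snoc (As := As) (A := A) as v s => act (snocIso (synOb T) As A).inv
    (tensor (tupArgs as) (toObj T (mk T v)) s : Q T _ (ctxObj (synOb T) As ⊗ tyObj (synOb T) A).ty)

theorem args_subst_left {Γ Δ Θ E E' F Γ₁ Y : Ctx G} {As : List (Ty G)} {A D : Ty G}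
    {s : Shuffle Γ Δ E} {p : Pick D E' E} {t : Shuffle E' Θ F} {p₁ : Pick D Γ₁ Γ}
    {s₁ : Shuffle Γ₁ Δ E'} {r₁ : Shuffle Γ₁ Θ Y} {r₂ : Shuffle Δ Y F} (as : Args S Γ As)
    (v : Tm S Δ A) (w : Tm S Θ D) (h : s.locate p = .inl ⟨Γ₁, p₁, s₁⟩)
    (h' : s₁.swap.assoc t = ⟨Y, r₁, r₂⟩) :
    (Args.snoc as v s).subst p w t = .snoc (as.subst p₁ w r₁) v r₂.swap := by
  simp only [Args.subst, h]
  rw [h']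

theorem args_subst_right {Γ Δ Θ E E' F Γ₂ Y : Ctx G} {As : List (Ty G)} {A D : Ty G}
    {s : Shuffle Γ Δ E} {p : Pick D E' E} {t : Shuffle E' Θ F} {p₂ : Pick D Γ₂ Δ}
    {s₂ : Shuffle Γ Γ₂ E'} {q₁ : Shuffle Γ₂ Θ Y} {q₂ : Shuffle Γ Y F} (as : Args S Γ As)
    (v : Tm S Δ A) (w : Tm S Θ D) (h : s.locate p = .inr ⟨Γ₂, p₂, s₂⟩)
    (h' : s₂.assoc t = ⟨Y, q₁, q₂⟩) :
    (Args.snoc as v s).subst p w t = .snoc as (v.subst p₂ w q₁) q₂ := by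
  simp only [Args.subst, h]
  rw [h']

/-- A Yoneda-type statement: a term former on argument families that commutes with substitution is
application of one closed function. It provides the interpretation of the operation symbols, whose
argument lists have arbitrary length. -/
theorem exists_ap_tupArgs {As : List (Ty G)} {C : Ty G} (h : {E : Ctx G} → Args S E As → Tm S E C)
    (nat : ∀ {A : Ty G} {Γ Δ E F : Ctx G} (as : Args S E As) (p : Pick A Γ E) (w : Tm S Δ A)
      (t : Shuffle Γ Δ F), (h as).subst p w t = h (as.subst p w t)) :
    ∃ k : Q T [] (.hom (ctxObj (synOb.{x, u, u', w} T) As).ty C), ∀ {E : Ctx G} (as : Args S E As),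
      ap k (tupArgs T as) = mk T (h as) := by
  induction As generalizing C with
  | nil =>
    obtain ⟨k, hk⟩ := exists_ap_star (mk T (h .nil))
    refine ⟨k, fun {E} as => ?_⟩
    cases as
    exact hk
  | cons A As ih =>
    -- The argument at the head of the list is abstracted; the shorter family is again natural,
    -- since substitution passes under the `λ` and into the other arguments.
    obtain ⟨k, hk⟩ := ih (C := .hom A C) (fun as => .lam (h (.snoc as .var (.right (.allLeft _)))))
      (fun {A'} {Γ} {Δ} {E} {F} as p w t => by
        have h₁ : (Shuffle.right (A := A) (.allLeft E)).locate (.there p) =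
            .inl ⟨_, p, .right (.allLeft Γ)⟩ := by
          simp only [Shuffle.locate, Shuffle.locate_allLeft]
        have h₂ : (Shuffle.right (A := A) (.allLeft Γ)).swap.assoc (.left t) =
            ⟨_, t, .left (.allRight F)⟩ := by
          simp only [Shuffle.swap, Shuffle.swap_allLeft, Shuffle.assoc]
          rw [Shuffle.assoc_allRight]
        rw [Tm.subst, nat, args_subst_left as .var w h₁ h₂, Shuffle.swap, Shuffle.swap_allRight])
    obtain ⟨g, hg⟩ := exists_ap_tensor_cast (ty_tyObj T A).symm k
    refine ⟨compFun (fn (snocIso (synOb T) As A).hom) g, fun {E} as => ?_⟩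
    cases as with
    | snoc as v s =>
    rw [ap_compFun, tupArgs]
    refine (congrArg (ap g) (act_snocIso_hom_inv T _)).trans ?_
    refine (hg _ _ _).trans ?_
    rw [hk]
    -- By β and naturality, the abstracted variable is replaced by the actual argument `v`.
    refine (app_lam (mk T _) (mk T v) s).trans (congrArg (mk T) ?_)
    change (h (.snoc as .var (.right (.allLeft _)))).subst .here v s = _
    rw [nat, args_subst_right (s₂ := .allLeft _) as .var v rfl (Shuffle.assoc_allLeft s)]
    rfl

/-- The interpretation in the syntactic category. -/
noncomputable def synInterpretation : Interpretation S (SynObj.{x, u, u', w} T) where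
  ob := synOb T
  op f := ofFn (cast (congrArg (Ty.hom _) (ty_tyObj T (S.cod f)).symm)
    (exists_ap_tupArgs T (fun as => Tm.op f as) (fun _ _ _ _ => rfl)).choose)

theorem act_synInterpretation_op (f : S.Op) {E : Ctx G} (as : Args S E (S.dom f)) :
    act ((synInterpretation.{x, u, u', v, w} T).op f) (tupArgs T as) =
      toObj T (mk T (.op f as)) := by
  refine (act_ofFn _ _).trans ((ap_cast (ty_tyObj T (S.cod f)).symm _ _ _).trans ?_)
  exact congrArg (toObj T)
    ((exists_ap_tupArgs T (fun as => Tm.op f as) (fun _ _ _ _ => rfl)).choose_spec as)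

mutual

theorem act_synInterpretation_tm : {Γ : Ctx G} → {A : Ty G} → (t : Tm S Γ A) →
    act ((synInterpretation.{x, u, u', v, w} T).tm t) (tup T Γ) = toObj T (mk T t)
  | _, _, .var => act_id _
  | _, _, .op f as => by
    rw [Interpretation.tm]
    refine (act_comp _ _ _).trans ?_
    rw [act_synInterpretation_args]
    exact act_synInterpretation_op T f as
  | _, _, .star => act_id _
  | _, _, .unitE v w s => by
    rw [Interpretation.tm]
    refine (act_comp _ _ _).trans ((congrArg (act _) (act_splitHom_tup T s)).trans ?_)
    refine (act_comp _ _ _).trans ((congrArg (act _) (act_whiskerRight _ _ _ _)).trans ?_)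
    refine (act_comp _ _ _).trans ((congrArg (act _) (act_leftUnitor_hom _ _ _)).trans ?_)
    rw [act_synInterpretation_tm v]
    exact (act_unitE _ _ _ _).trans ((congrArg (unitE (mk T v) · s)
      (act_synInterpretation_tm w)).trans (unitE_cast _ _ _ _))
  | _, _, .tensor v w s => by
    rw [Interpretation.tm]
    refine (act_comp _ _ _).trans ((congrArg (act _) (act_splitHom_tup T s)).trans ?_)
    refine (act_tensorHom _ _ _ _ _).trans ?_
    rw [act_synInterpretation_tm v, act_synInterpretation_tm w]
    exact tensor_cast _ _ _ _ _ _
  | _, _, .pm (Δ := Δ) (A := A) (B := A') v w s => by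
    rw [Interpretation.tm]
    refine (act_comp _ _ _).trans ((congrArg (act _) (act_splitHom_tup T s)).trans ?_)
    refine (act_comp _ _ _).trans ((congrArg (act _) (act_whiskerRight _ _ _ _)).trans ?_)
    rw [act_synInterpretation_tm v]
    refine (act_comp _ _ _).trans ((congrArg (act _) (act_braiding _ _ _)).trans ?_)
    refine (act_comp _ _ _).trans ((congrArg (act _) ((act_ofFn _ _).trans
      (ap_assocInvFun_cast (ty_tyObj T A).symm (ty_tyObj T A').symm _ _ _ _))).trans ?_)
    rw [Shuffle.swap_swap]
    refine (act_pm _ _ _ _).trans ((congrArg (pm (mk T v) · s) ?_).trans (pm_cast _ _ (mk T w) s))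
    refine (act_comp _ _ _).trans ((congrArg (act _) (act_whiskerRight _ _ _ _)).trans ?_)
    refine (congrArg (fun u => act _ (tensor u _ _)) (act_snocIso_inv_tup T Δ A)).trans ?_
    refine (act_comp _ _ _).trans ((congrArg (act _) (act_snocIso_inv_tup T (A :: Δ) A')).trans ?_)
    exact act_synInterpretation_tm w
  | _, _, .lam (Γ := Γ) (A := A) (B := C) v => by
    rw [Interpretation.tm, SynObj.curry_eq]
    refine (act_ofFn _ _).trans ?_
    refine ap_curryFun_cast (ty_tyObj T A).symm (ty_tyObj T C).symm
      (ty_tyObj T (.hom A C)).symm _ _ (mk T v) ?_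
    refine (ap_compFun _ _ _).trans ((congrArg (ap _) (ap_swapFun _ _ _)).trans ?_)
    refine (act_comp _ _ _).trans ((congrArg (act _) (act_braiding _ _ _)).trans ?_)
    rw [Shuffle.swap_swap]
    refine (act_comp _ _ _).trans ((congrArg (act _) (act_snocIso_inv_tup T Γ A)).trans ?_)
    exact act_synInterpretation_tm v
  | _, _, .app v w s => by
    rw [Interpretation.tm]
    refine (act_comp _ _ _).trans ((congrArg (act _) (act_splitHom_tup T s)).trans ?_)
    refine (act_comp _ _ _).trans ((congrArg (act _) (act_tensorHom _ _ _ _ _)).trans ?_)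
    refine (act_comp _ _ _).trans ((congrArg (act _) (act_braiding _ _ _)).trans ?_)
    rw [act_synInterpretation_tm v, act_synInterpretation_tm w]
    refine (act_ev _ _ _).trans ?_
    rw [Shuffle.swap_swap]
    exact app_cast _ _ _ _ _ _
  | _, _, .dis v => unit_ext _ _

theorem act_synInterpretation_args : {E : Ctx G} → {As : List (Ty G)} → (as : Args S E As) →
    act ((synInterpretation.{x, u, u', v, w} T).args as) (tup T E) = tupArgs T as
  | _, _, .nil => act_id _
  | _, _, .snoc as v s => by
    rw [Interpretation.args]
    refine (act_comp _ _ _).trans ?_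
    refine (congrArg (act _) (act_splitHom_tup T s)).trans ?_
    refine (act_comp _ _ _).trans ?_
    refine (congrArg (act _) (act_tensorHom _ _ _ _ _)).trans ?_
    rw [act_synInterpretation_args as, act_synInterpretation_tm v]
    rfl

end

/-- Extensionality for a whole context: currying splits off one variable at a time, without changing
distances. -/
theorem dist_le_of_ap_tup (Γ : Ctx G) {C : Ty G}
    (f g : Q T [] (.hom (ctxObj (synOb.{x, u, u', w} T) Γ).ty C)) :
    Q.dist (ap f (tup T Γ)) (ap g (tup T Γ)) ≤ Q.dist f g := by
  induction Γ generalizing C with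
  | nil => exact dist_le_of_app_star f g
  | cons A Γ ih =>
    cases Γ with
    | nil => exact dist_le_of_app_cast_var (ty_tyObj T A).symm f g
    | cons A' Γ =>
      refine le_trans ?_ ((ih (curryFun f) (curryFun g)).trans_eq (dist_curryFun f g))
      refine le_trans ?_ (dist_le_of_app_cast_var (ty_tyObj T A).symm _ _)
      exact (congrArg₂ Q.dist (app_ap_curryFun f _ _ _) (app_ap_curryFun g _ _ _)).ge

/-- One inequality holds because application does not decrease `dist`, the other by extensionality
on the tuple of variables. Thus the syntactic interpretation satisfies exactly what `synDist`
prescribes. -/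
theorem hdist_synInterpretation {Γ : Ctx G} {A : Ty G} (t s : Tm S Γ A) :
    EnrichedAffine.hdist ((synInterpretation.{x, u, u', v, w} T).tm t)
      ((synInterpretation.{x, u, u', v, w} T).tm s) = T.synDist t s := by
  have h := congrArg₂ Q.dist (act_synInterpretation_tm.{x, u, u', v, w} T t)
    (act_synInterpretation_tm.{x, u, u', v, w} T s)
  refine Eq.trans (le_antisymm ?_ ?_) (h.trans (dist_cast _ (mk T t) (mk T s)))
  · exact dist_app_le _ _ _ _
  · exact dist_le_of_ap_tup T Γ _ _

end Completeness

-- Smallness, the terminal unit and the generic model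

section

variable {V : Type x} [CommMonoid V] [CompleteLattice V] [IsQuantale V] {B : Set V} {G : Type u}
  {S : Signature.{u, u'} G} (T : AffineTheory V B S) [T.Integral]

open Q

theorem AffineTheory.Varietal.small {T : AffineTheory V B S} [T.Integral]
    (h : AffineTheory.Varietal.{x, u, u', v} T) (A C : Ty G) :
    Small.{v} (Q T [] (.hom A C)) :=
  have := h A C
  -- `Q T [A] C` and `T.SynHom A C` are quotients by the same relation, and a closed function is
  -- determined by its value on a variable.
  small_of_injective (β := T.SynHom A C) (f := fun f => (ap f (var T) : Q T [A] C))
    fun _ _ e => fun_ext e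

theorem AffineTheory.nonempty_unique_synHom_unit (A : Ty G) :
    Nonempty (Unique (T.SynHom A .unit)) :=
  ⟨{ default := (dis (var T) : Q T [A] .unit)
     uniq := fun f => unit_ext (T := T) (Γ := [A]) f (dis (var T)) }⟩

theorem isModel_synInterpretation [∀ A C : Ty G, Small.{v} (Q T [] (.hom A C))] :
    (synInterpretation.{x, u, u', v, w} T).IsModel T := fun _ _ _ h =>
  (le_synDist (.ax h)).trans_eq (hdist_synInterpretation T _ _).symm

end

end AffineLambda

theorem mainTheorem7 {V : Type x} [CommMonoid V] [CompleteLattice V] [IsQuantale V]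
    (integral : (1 : V) = ⊤) (continuous : AffineLambda.IsContinuousLattice V)
    (B : Set V) (basis : AffineLambda.IsLatticeBasis B)
    (sSup_mem : ∀ F : Set V, F ⊆ B → F.Finite → sSup F ∈ B)
    (mul_mem : ∀ q ∈ B, ∀ r ∈ B, q * r ∈ B) (one_mem : (1 : V) ∈ B)
    {G : Type u} (S : AffineLambda.Signature.{u, u'} G) (T : AffineLambda.AffineTheory V B S)
    (varietal : AffineLambda.AffineTheory.Varietal.{x, u, u', v} T) :
    (∀ (Γ : AffineLambda.Ctx G) (A : AffineLambda.Ty G) (t s : AffineLambda.Tm S Γ A),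
      ∀ q ∈ B,
        (AffineLambda.Thm T t q s ↔
          ∀ (C : Type (max u w)) [Category.{v} C] [SemiCartesianMonoidalCategory C]
            [SymmetricCategory C] [MonoidalClosed C] [AffineLambda.EnrichedAffine V C]
            (M : AffineLambda.Interpretation S C), M.IsModel T → M.Satisfies t q s)) ∧
      ∀ A : AffineLambda.Ty G, Nonempty (Unique (T.SynHom A AffineLambda.Ty.unit)) := by
  have : T.Integral := ⟨integral⟩
  have (A C : AffineLambda.Ty G) : Small.{v} (AffineLambda.Q T [] (.hom A C)) := varietal.small A C
  refine ⟨fun Γ A t s q hq => ⟨fun h C _ _ _ _ _ M hM => ?_, fun h => ?_⟩,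
    T.nonempty_unique_synHom_unit⟩
  · exact AffineLambda.satisfies_of_thm M basis integral hM h
  -- Only one model is needed: the syntactic one, whose objects are placed in the universe `max u w`
  -- over which the statement ranges.
  · refine AffineLambda.thm_of_le_synDist hq ?_
    rw [← AffineLambda.hdist_synInterpretation.{x, u, u', v, w} T t s]
    exact h _ _ (AffineLambda.isModel_synInterpretation T)
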